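/- **Notation.** Let $m\ge 1$. Let $C=(c_{ik})\in\mathbb Z^{n\times m}$ ($n$ arbitrary) be an integer matrix with rows $C_1,\dots,C_n$, all non-zero, which is *regular* (every column sums to $0$) and of full rank $m$; no condition is imposed on the greatest common divisor $g_C$ of the maximal minors of $C$. Put $l_i(u)=\langle C_i,u\rangle$ for $u\in\mathbb C^m$. The *Horn–Kapranov parametrization* of $C$ is the rational map $$\psi_C:\mathbb P^{m-1}\dashrightarrow\mathbb C^m,\qquad \psi_C(u)_k=\prod_{i=1}^n l_i(u)^{c_{ik}}\quad(k=1,\dots,m),$$ which is well defined because its coordinates are homogeneous of degree $0$. Let $S_C\subset\mathbb C^m$ be the Zariski closure of its image. The matrix $C$ is *defective* if $\operatorname{codim}(S_C)>1$, and non-defective otherwise. For $\lambda\in(\mathbb C^*)^m$, $\lambda\cdot$ denotes coordinatewise multiplication by $\lambda$. For an irreducible hypersurface $S=\{\Delta=0\}\subset\mathbb C^m$, $\Delta$ an irreducible polynomial, the *logarithmic Gauss map* is $$\gamma_S:S\dashrightarrow\mathbb P^{m-1},\qquad \gamma_S(y)=\Bigl(y_1\tfrac{\partial\Delta}{\partial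 y_1}(y):\dots:y_m\tfrac{\partial\Delta}{\partial y_m}(y)\Bigr)$$ (if $S$ is a coordinate hyperplane, these coordinates vanish identically on $S$, and $\gamma_S$ is then not birational, by convention). **Theorem.** Let $S\subset\mathbb C^m$ be an irreducible algebraic hypersurface. 1. The logarithmic Gauss map $\gamma_S:S\dashrightarrow\mathbb P^{m-1}$ is birational if and only if there exist an $n$, a non-defective, regular integer matrix $C\in\mathbb Z^{n\times m}$ of full rank $m$ without zero rows, and a $\lambda\in(\mathbb C^*)^m$ such that $S=\lambda\cdot S_C$. 2. Moreover, for all such $C$ and $\lambda$ with $S=\lambda\cdot S_C$, the rational map $\lambda\cdot\psi_C:\mathbb P^{m-1}\dashrightarrow S$ is birational, and $\gamma_S$ is its inverse. 3. In particular, for every non-defective, regular integer matrix $C$ of full rank $m$ without zero rows, $\psi_C:\mathbb P^{m-1}\dashrightarrow S_C$ has degree $1$, that is, a generic point of $S_C$ has exactly one preimage in $\mathbb P^{m-1}$. -/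

import Mathlib

open scoped LinearAlgebra.Projectivization

noncomputable section

namespace HornKapranov

/-! ### Zariski topology on affine space -/

/-- The Zariski closure in `ℂ^m` of a set `V`. -/
def zariskiClosure {m : ℕ} (V : Set (Fin m → ℂ)) : Set (Fin m → ℂ) :=
  MvPolynomial.zeroLocus ℂ (MvPolynomial.vanishingIdeal ℂ V)

/-- The codimension in `ℂ^m` of (the Zariski closure of) `V`: the height of its vanishing ideal. -/
def codim {m : ℕ} (V : Set (Fin m → ℂ)) : ℕ∞ :=
  (MvPolynomial.vanishingIdeal ℂ V).height

/-- `Δ` is a minimal equation of the irreducible hypersurface `S ⊆ ℂ^m`: `Δ` is an irreducible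
polynomial and `S` is its zero set. -/
structure IsMinimalEquation {m : ℕ} (Δ : MvPolynomial (Fin m) ℂ) (S : Set (Fin m → ℂ)) :
    Prop where
  irreducible : Irreducible Δ
  zeroSet : S = {y | MvPolynomial.eval y Δ = 0}

/-- `p` holds at the generic point of `V`: it holds on a nonempty (relatively) Zariski open subset
of `V`. As principal open sets are a basis, the open subset may be taken principal. -/
def GenericallyOn {m : ℕ} (V : Set (Fin m → ℂ)) (p : (Fin m → ℂ) → Prop) : Prop :=
  ∃ P : MvPolynomial (Fin m) ℂ, (∃ y ∈ V, MvPolynomial.eval y P ≠ 0) ∧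
    ∀ y ∈ V, MvPolynomial.eval y P ≠ 0 → p y

/-- `p` holds at the generic point of the projective space of lines in `ℂ^k`: it holds on a
nonempty Zariski open subset, which may be taken to be the complement of the zero set of a
homogeneous polynomial. -/
def GenericallyOnProj {k : ℕ} (p : ℙ ℂ (Fin k → ℂ) → Prop) : Prop :=
  ∃ (d : ℕ) (P : MvPolynomial (Fin k) ℂ), P.IsHomogeneous d ∧
    (∃ u : ℙ ℂ (Fin k → ℂ), MvPolynomial.eval u.rep P ≠ 0) ∧
    ∀ u : ℙ ℂ (Fin k → ℂ), MvPolynomial.eval u.rep P ≠ 0 → p u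

/-! ### Rational maps between an affine variety and a projective space -/

/-- Polynomial homogeneous coordinates `y ↦ (g_1(y) : ⋯ : g_k(y))` of a rational map from a
subvariety of `ℂ^m` to `ℙ^{k-1}`. They define a rational map on an irreducible closed set `V`
when they do not all vanish identically on `V`. -/
structure AffToProj (m k : ℕ) where
  coord : Fin k → MvPolynomial (Fin m) ℂ

/-- The vector `(g_1(y), …, g_k(y))`. -/
def AffToProj.vec {m k : ℕ} (γ : AffToProj m k) (y : Fin m → ℂ) : Fin k → ℂ :=
  fun i => MvPolynomial.eval y (γ.coord i)

/-- The point `(g_1(y) : ⋯ : g_k(y))` of projective space. -/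
def AffToProj.value {m k : ℕ} (γ : AffToProj m k) (y : Fin m → ℂ) (hy : γ.vec y ≠ 0) :
    ℙ ℂ (Fin k → ℂ) :=
  Projectivization.mk ℂ (γ.vec y) hy

/-- A rational map `u ↦ (f_1(u) / f_0(u), …, f_m(u) / f_0(u))` from `ℙ^{k-1}` to `ℂ^m`, where
`f_0 ≠ 0, f_1, …, f_m` are homogeneous polynomials of the same degree. -/
structure ProjToAff (k m : ℕ) where
  deg : ℕ
  den : MvPolynomial (Fin k) ℂ
  num : Fin m → MvPolynomial (Fin k) ℂ
  den_ne_zero : den ≠ 0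
  den_homogeneous : den.IsHomogeneous deg
  num_homogeneous : ∀ j, (num j).IsHomogeneous deg

/-- The denominator does not vanish at `u`. -/
def ProjToAff.DefinedAt {k m : ℕ} (φ : ProjToAff k m) (u : ℙ ℂ (Fin k → ℂ)) : Prop :=
  MvPolynomial.eval u.rep φ.den ≠ 0

/-- The value at `u`, computed with an arbitrary representative (see `ProjToAff.value_mk`). -/
def ProjToAff.value {k m : ℕ} (φ : ProjToAff k m) (u : ℙ ℂ (Fin k → ℂ)) : Fin m → ℂ :=
  fun j => MvPolynomial.eval u.rep (φ.num j) / MvPolynomial.eval u.rep φ.den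

theorem eval_smul_of_isHomogeneous {k d : ℕ} {P : MvPolynomial (Fin k) ℂ}
    (hP : P.IsHomogeneous d) (a : ℂ) (v : Fin k → ℂ) :
    MvPolynomial.eval (a • v) P = a ^ d * MvPolynomial.eval v P := by
  rw [MvPolynomial.eval_eq, MvPolynomial.eval_eq, Finset.mul_sum]
  refine Finset.sum_congr rfl fun s hs => ?_
  have hd : ∑ i ∈ s.support, s i = d := (hP.degree_eq_sum_deg_support hs).symm
  simp only [Pi.smul_apply, smul_eq_mul, mul_pow, Finset.prod_mul_distrib,
    Finset.prod_pow_eq_pow_sum, hd]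
  ring

/-- The value does not depend on the representative. -/
theorem ProjToAff.value_mk {k m : ℕ} (φ : ProjToAff k m) (v : Fin k → ℂ) (hv : v ≠ 0) :
    φ.value (Projectivization.mk ℂ v hv) =
      fun j => MvPolynomial.eval v (φ.num j) / MvPolynomial.eval v φ.den := by
  obtain ⟨a, ha⟩ := Projectivization.exists_smul_eq_mk_rep ℂ v hv
  funext j
  have ha0 : ((a : ℂ) ^ φ.deg) ≠ 0 := pow_ne_zero _ a.ne_zero
  simp only [ProjToAff.value]
  rw [← ha, Units.smul_def, eval_smul_of_isHomogeneous (φ.num_homogeneous j),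
    eval_smul_of_isHomogeneous φ.den_homogeneous, mul_div_mul_left _ _ ha0]

/-- Definedness does not depend on the representative. -/
theorem ProjToAff.definedAt_mk {k m : ℕ} (φ : ProjToAff k m) (v : Fin k → ℂ) (hv : v ≠ 0) :
    φ.DefinedAt (Projectivization.mk ℂ v hv) ↔ MvPolynomial.eval v φ.den ≠ 0 := by
  obtain ⟨a, ha⟩ := Projectivization.exists_smul_eq_mk_rep ℂ v hv
  have ha0 : ((a : ℂ) ^ φ.deg) ≠ 0 := pow_ne_zero _ a.ne_zero
  simp only [ProjToAff.DefinedAt]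
  rw [← ha, Units.smul_def, eval_smul_of_isHomogeneous φ.den_homogeneous]
  simp [ha0]

/-- The torus translate `τ · φ`. -/
def ProjToAff.translate {k m : ℕ} (τ : Fin m → ℂˣ) (φ : ProjToAff k m) : ProjToAff k m where
  deg := φ.deg
  den := φ.den
  num j := MvPolynomial.C (τ j : ℂ) * φ.num j
  den_ne_zero := φ.den_ne_zero
  den_homogeneous := φ.den_homogeneous
  num_homogeneous j := by
    simpa using (MvPolynomial.isHomogeneous_C (Fin k) (τ j : ℂ)).mul (φ.num_homogeneous j)

/-- `γ : S ⇢ ℙ^{k-1}` and `φ : ℙ^{k-1} ⇢ S` are mutually inverse rational maps: `φ` generically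
takes its values in `S`, and both composites are generically defined and equal to the identity. -/
def MutuallyInverse {m k : ℕ} (S : Set (Fin m → ℂ)) (γ : AffToProj m k) (φ : ProjToAff k m) :
    Prop :=
  (GenericallyOn S fun y => ∃ hy : γ.vec y ≠ 0,
    φ.DefinedAt (γ.value y hy) ∧ φ.value (γ.value y hy) = y) ∧
  (GenericallyOnProj fun u => φ.DefinedAt u ∧ φ.value u ∈ S ∧
    ∃ hu : γ.vec (φ.value u) ≠ 0, γ.value (φ.value u) hu = u)

/-- The rational map `γ : S ⇢ ℙ^{k-1}` is birational: it has an inverse rational map. -/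
def AffToProj.IsBirationalOn {m k : ℕ} (S : Set (Fin m → ℂ)) (γ : AffToProj m k) : Prop :=
  ∃ φ : ProjToAff k m, MutuallyInverse S γ φ

/-- The rational map `φ : ℙ^{k-1} ⇢ S` is birational: it has an inverse rational map. -/
def ProjToAff.IsBirationalOnto {m k : ℕ} (S : Set (Fin m → ℂ)) (φ : ProjToAff k m) : Prop :=
  ∃ γ : AffToProj m k, MutuallyInverse S γ φ

/-- As a map to its closed image, `φ` has degree `d`: a generic point of the closed image has
exactly `d` preimages. -/
def ProjToAff.HasDegree {m k : ℕ} (φ : ProjToAff k m) (d : ℕ) : Prop :=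
  GenericallyOn (zariskiClosure {y | ∃ u, φ.DefinedAt u ∧ φ.value u = y}) fun y =>
    {u | φ.DefinedAt u ∧ φ.value u = y}.encard = d

/-! ### The logarithmic Gauss map -/

/-- The logarithmic Gauss map `y ↦ (y_1 ∂Δ/∂y_1 (y) : ⋯ : y_m ∂Δ/∂y_m (y))` of the hypersurface
with minimal equation `Δ`. -/
def logGauss {m : ℕ} (Δ : MvPolynomial (Fin m) ℂ) : AffToProj m m where
  coord i := MvPolynomial.X i * MvPolynomial.pderiv i Δ

/-- The tangent space at `y` of the closed set `S`. -/
def tangentSpace {m : ℕ} (S : Set (Fin m → ℂ)) (y : Fin m → ℂ) : Set (Fin m → ℂ) :=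
  {v | ∀ P ∈ MvPolynomial.vanishingIdeal ℂ S,
    ∑ i, MvPolynomial.eval y (MvPolynomial.pderiv i P) * v i = 0}

/-- The logarithmic Gauss map is the left Gauss map of the torus: its vector at `y` is an equation
of the translate to the identity, `y⁻¹ · T_y S`, of the tangent space of `S` at `y`. -/
theorem logGauss_vec_eq_zero_iff {m : ℕ} {Δ : MvPolynomial (Fin m) ℂ} {S : Set (Fin m → ℂ)}
    (h : IsMinimalEquation Δ S) {y : Fin m → ℂ} (hy : y ∈ S) (w : Fin m → ℂ) :
    ∑ i, (logGauss Δ).vec y i * w i = 0 ↔ (fun i => y i * w i) ∈ tangentSpace S y := by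
  have hv : ∀ i, (logGauss Δ).vec y i * w i =
      MvPolynomial.eval y (MvPolynomial.pderiv i Δ) * (y i * w i) := by
    intro i
    simp [AffToProj.vec, logGauss]
    ring
  simp only [hv]
  have hS : S = MvPolynomial.zeroLocus ℂ (Ideal.span {Δ}) := by
    rw [h.zeroSet, MvPolynomial.zeroLocus_span]
    ext x
    simp [MvPolynomial.aeval_eq_eval]
  constructor
  · intro hw P hP
    rw [hS, MvPolynomial.vanishingIdeal_zeroLocus_eq_radical,
      ((Ideal.span_singleton_prime h.irreducible.ne_zero).2 h.irreducible.prime).radical,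
      Ideal.mem_span_singleton] at hP
    obtain ⟨Q, rfl⟩ := hP
    have hy0 : MvPolynomial.eval y Δ = 0 := by
      rw [h.zeroSet] at hy
      exact hy
    have key : ∀ i, MvPolynomial.eval y (MvPolynomial.pderiv i (Δ * Q)) * (y i * w i) =
        MvPolynomial.eval y Q *
          (MvPolynomial.eval y (MvPolynomial.pderiv i Δ) * (y i * w i)) := by
      intro i
      simp [Derivation.leibniz, hy0]
      ring
    simp only [key]
    rw [← Finset.mul_sum, hw, mul_zero]
  · intro hw
    refine hw Δ fun x hx => ?_
    rw [h.zeroSet] at hx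
    simpa [MvPolynomial.aeval_eq_eval] using hx

/-! ### Horn–Kapranov parametrizations -/

/-- The linear form `l_i(u) = ⟨C_i, u⟩` given by the `i`-th row of `C`. -/
def linForm {n m : ℕ} (C : Matrix (Fin n) (Fin m) ℤ) (i : Fin n) (u : Fin m → ℂ) : ℂ :=
  ∑ k, (C i k : ℂ) * u k

/-- `ψ_C(u)_k = ∏ i, l_i(u) ^ c_{ik}`. -/
def psi {n m : ℕ} (C : Matrix (Fin n) (Fin m) ℤ) (u : Fin m → ℂ) : Fin m → ℂ :=
  fun k => ∏ i, linForm C i u ^ C i k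

/-- The set of points `u` where no linear form occurring with a negative exponent in some
coordinate of `ψ_C` vanishes. -/
def psiDomain {n m : ℕ} (C : Matrix (Fin n) (Fin m) ℤ) : Set (Fin m → ℂ) :=
  {u | ∀ i k, C i k < 0 → linForm C i u ≠ 0}

/-- `S_C ⊆ ℂ^m`: the Zariski closure of the image of `ψ_C`. -/
def SC {n m : ℕ} (C : Matrix (Fin n) (Fin m) ℤ) : Set (Fin m → ℂ) :=
  zariskiClosure (psi C '' psiDomain C)

/-- `C` is defective when `S_C` has codimension greater than one. -/
def Defective {n m : ℕ} (C : Matrix (Fin n) (Fin m) ℤ) : Prop :=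
  1 < codim (SC C)

/-- The matrices defining Horn–Kapranov parametrizations: integer matrices which are regular (each
column sums up to zero), have no zero row, and have full rank `m`. -/
structure IsHornMatrix {n m : ℕ} (C : Matrix (Fin n) (Fin m) ℤ) : Prop where
  regular : ∀ k, ∑ i, C i k = 0
  row_ne_zero : ∀ i, C i ≠ 0
  full_rank : (C.map (Int.cast : ℤ → ℚ)).rank = m

/-- The linear form `l_i` as a polynomial. -/
def linPoly {n m : ℕ} (C : Matrix (Fin n) (Fin m) ℤ) (i : Fin n) : MvPolynomial (Fin m) ℂ :=
  ∑ k, MvPolynomial.C (C i k : ℂ) * MvPolynomial.X k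

/-- The exponent `- min {0, c_{ik} : k}` of `l_i` in the least common denominator `f_0`. -/
def denExp {n m : ℕ} (C : Matrix (Fin n) (Fin m) ℤ) (i : Fin n) : ℕ :=
  Finset.univ.sup fun k => (-(C i k)).toNat

theorem neg_le_denExp {n m : ℕ} (C : Matrix (Fin n) (Fin m) ℤ) (i : Fin n) (k : Fin m) :
    0 ≤ C i k + denExp C i := by
  have h : (-(C i k)).toNat ≤ denExp C i :=
    Finset.le_sup (f := fun k => (-(C i k)).toNat) (Finset.mem_univ k)
  omega

theorem linPoly_ne_zero {n m : ℕ} {C : Matrix (Fin n) (Fin m) ℤ} {i : Fin n} (h : C i ≠ 0) :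
    linPoly C i ≠ 0 := by
  classical
  intro h0
  apply h
  funext k
  have h1 := congrArg (MvPolynomial.eval (Pi.single k (1 : ℂ))) h0
  simpa [linPoly, Pi.single_apply] using h1

theorem linPoly_isHomogeneous {n m : ℕ} (C : Matrix (Fin n) (Fin m) ℤ) (i : Fin n) :
    (linPoly C i).IsHomogeneous 1 :=
  MvPolynomial.IsHomogeneous.sum _ _ _ fun k _ => MvPolynomial.isHomogeneous_C_mul_X _ k

/-- `ψ_C` as a rational map on `ℙ^{m-1}`, written as `(f_1 / f_0, …, f_m / f_0)` with the least
common denominator `f_0 = ∏ i, l_i ^ (- min {0, c_{ik} : k})`. -/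
def hornKapranov {n m : ℕ} (C : Matrix (Fin n) (Fin m) ℤ) (hC : IsHornMatrix C) :
    ProjToAff m m where
  deg := ∑ i, denExp C i
  den := ∏ i, linPoly C i ^ denExp C i
  num k := ∏ i, linPoly C i ^ (C i k + denExp C i).toNat
  den_ne_zero := Finset.prod_ne_zero_iff.2 fun i _ =>
    pow_ne_zero _ (linPoly_ne_zero (hC.row_ne_zero i))
  den_homogeneous := MvPolynomial.IsHomogeneous.prod _ _ _ fun i _ => by
    simpa using (linPoly_isHomogeneous C i).pow (denExp C i)
  num_homogeneous k := by
    have hdeg : ∑ i, denExp C i = ∑ i, (C i k + denExp C i).toNat := by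
      zify
      simp only [Int.toNat_of_nonneg (neg_le_denExp C _ k), Finset.sum_add_distrib,
        hC.regular k, zero_add]
    rw [hdeg]
    exact MvPolynomial.IsHomogeneous.prod _ _ _ fun i _ => by
      simpa using (linPoly_isHomogeneous C i).pow (C i k + denExp C i).toNat

theorem eval_linPoly {n m : ℕ} (C : Matrix (Fin n) (Fin m) ℤ) (i : Fin n) (u : Fin m → ℂ) :
    MvPolynomial.eval u (linPoly C i) = linForm C i u := by
  simp [linPoly, linForm]

/-- The domain of the rational map on projective space is the domain of `psi`. -/
theorem hornKapranov_definedAt_mk {n m : ℕ} {C : Matrix (Fin n) (Fin m) ℤ} (hC : IsHornMatrix C)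
    (u : Fin m → ℂ) (hu : u ≠ 0) :
    (hornKapranov C hC).DefinedAt (Projectivization.mk ℂ u hu) ↔ u ∈ psiDomain C := by
  rw [ProjToAff.definedAt_mk]
  simp only [hornKapranov, map_prod, map_pow, eval_linPoly, Finset.prod_ne_zero_iff,
    Finset.mem_univ, true_implies, psiDomain, Set.mem_ofPred_eq]
  refine forall_congr' fun i => ?_
  constructor
  · intro h k hk h0
    have hle := neg_le_denExp C i k
    exact h (by rw [h0]; exact zero_pow (by omega))
  · intro h
    by_cases he : denExp C i = 0
    · simp [he]
    · have hex : ∃ k, C i k < 0 := by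
        by_contra! hcon
        apply he
        have : denExp C i ≤ 0 := Finset.sup_le fun k _ => by
          have := hcon k
          omega
        omega
      obtain ⟨k, hk⟩ := hex
      exact pow_ne_zero _ (h k hk)

/-- The rational map on projective space is induced by `psi`. -/
theorem hornKapranov_value_mk {n m : ℕ} {C : Matrix (Fin n) (Fin m) ℤ} (hC : IsHornMatrix C)
    (u : Fin m → ℂ) (hu : u ≠ 0) (hd : u ∈ psiDomain C) :
    (hornKapranov C hC).value (Projectivization.mk ℂ u hu) = psi C u := by
  rw [ProjToAff.value_mk]
  have hden := (hornKapranov_definedAt_mk hC u hu).2 hd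
  rw [ProjToAff.definedAt_mk] at hden
  funext k
  rw [div_eq_iff hden]
  simp only [hornKapranov, map_prod, map_pow, eval_linPoly, psi]
  rw [← Finset.prod_mul_distrib]
  refine Finset.prod_congr rfl fun i _ => ?_
  have hle := neg_le_denExp C i k
  by_cases h0 : linForm C i u = 0
  · have he : denExp C i = 0 := by
      by_contra he
      apply hden
      simp only [hornKapranov, map_prod, map_pow, eval_linPoly]
      exact Finset.prod_eq_zero (Finset.mem_univ i) (by rw [h0]; exact zero_pow he)
    rw [he] at hle ⊢
    have hc : 0 ≤ C i k := by simpa using hle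
    rw [← zpow_natCast]
    simp [Int.toNat_of_nonneg hc]
  · rw [← zpow_natCast, ← zpow_natCast, ← zpow_add₀ h0, Int.toNat_of_nonneg hle]

/-- The torus translate `τ · V`. -/
def torusTranslate {m : ℕ} (τ : Fin m → ℂˣ) (V : Set (Fin m → ℂ)) : Set (Fin m → ℂ) :=
  (fun y k => (τ k : ℂ) * y k) '' V

end HornKapranov

end

namespace HornKapranov

/-! Everything takes place in the field `K` of rational functions in u_1, …, u_m over ℂ. A rational
map φ from ℙ^{m-1} is recorded by its generic value g in K^m: a polynomial vanishes on the closure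
of the image of φ exactly when it vanishes at g. Being inverse to the logarithmic Gauss map is
translated into the system ∑ u_k · D(g_k)/g_k = 0 for all ℂ-derivations D of `K`
(`IsLogGaussSection`).

Differentiating Δ(g) = 0 gives the same system with u replaced by the Gauss vector (g_k ∂_kΔ(g))_k.
If this vector is proportional to u, the system follows (`IsGenericLeftInverse.isLogGaussSection`).
Conversely, if Δ generates the relations of g, then m-1 of the g_k are algebraically independent,
derivations take arbitrary values on them, and the logarithmic derivatives span a hyperplane. Both u
and the Gauss vector are equations of it, so they are proportional
(`IsLogGaussSection.isGenericLeftInverse`).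

Horn–Kapranov maps solve the system: contracting ∑_i c_{ik} D(l_i)/l_i with u_k leaves ∑_i D(l_i),
which is 0 by regularity. For the converse, write the g_k as monomials with exponents c_h in
pairwise non-associated primes h, and put l_h = ⟨c_h, u⟩. The system says ∑_h l_h ∂_j h / h = 0 for
all j. Comparing residues, h divides l_h ∂_j h, hence l_h, so h is proportional to l_h when c_h ≠ 0.
Homogeneity of degree 0 makes the exponents regular, and full rank is achieved by adding rows ±e_j.
-/

/-! ### Extension of derivations and logarithmic derivatives -/

open TensorProduct in
/-- A derivation extends along a formally étale algebra. -/
theorem exists_derivation_of_formallyEtale {k A K : Type*} [CommRing k] [CommRing A] [CommRing K]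
    [Algebra k A] [Algebra k K] [Algebra A K] [IsScalarTower k A K] [Algebra.FormallyEtale A K]
    (d : Derivation k A K) : ∃ D : Derivation k K K, ∀ a, D (algebraMap A K a) = d a := by
  -- For a formally étale algebra Ω[K⁄k] is the base change of Ω[A⁄k], so the functional given by
  -- `d` extends `K`-linearly.
  let f : Ω[K⁄k] →ₗ[K] K := (LinearMap.liftBaseChange K d.liftKaehlerDifferential) ∘ₗ
    (KaehlerDifferential.tensorKaehlerEquivOfFormallyEtale k A K).symm.toLinearMap
  refine ⟨f.compDer (KaehlerDifferential.D k K), fun a => ?_⟩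
  simp [f, KaehlerDifferential.tensorKaehlerEquivOfFormallyEtale_symm_D_algebraMap]

/-- A transcendence basis of a field of characteristic zero is a formally étale chart. -/
theorem exists_derivation_of_isTranscendenceBasis {ι k K : Type*} [Field k] [CharZero k]
    [Field K] [Algebra k K] {x : ι → K} (hx : IsTranscendenceBasis k x) (w : ι → K) :
    ∃ D : Derivation k K K, ∀ i, D (x i) = w i := by
  -- The tower k[x] ⊆ k(x) ⊆ K is formally étale in each step: first a localization, then an
  -- algebraic extension, separable in characteristic zero.
  let : Algebra (MvPolynomial ι k) K := (MvPolynomial.aeval (R := k) x).toAlgebra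
  have hmap : ∀ p, algebraMap (MvPolynomial ι k) K p = MvPolynomial.aeval x p := fun _ => rfl
  have : IsScalarTower k (MvPolynomial ι k) K := .of_algebraMap_eq fun r => by
    rw [hmap, MvPolynomial.algebraMap_eq, MvPolynomial.aeval_C]
  have : FaithfulSMul (MvPolynomial ι k) K :=
    (faithfulSMul_iff_algebraMap_injective _ _).2 hx.1
  let : Algebra (FractionRing (MvPolynomial ι k)) K := FractionRing.liftAlgebra _ K
  have : IsScalarTower (MvPolynomial ι k) (FractionRing (MvPolynomial ι k)) K :=
    inferInstance
  have : Algebra.IsAlgebraic (MvPolynomial ι k) K := by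
    have := hx.isAlgebraic
    exact ⟨fun a => (isAlgebraic_ringHom_iff_of_comp_eq (hx.1.aevalEquiv : _ ≃+* _)
      (RingHom.id K) Function.injective_id
      (by ext <;> simp [hmap])).1 (this.isAlgebraic a)⟩
  have : Algebra.IsAlgebraic (FractionRing (MvPolynomial ι k)) K :=
    Algebra.IsAlgebraic.extendScalars (R := MvPolynomial ι k) (IsFractionRing.injective _ _)
  have : Algebra.FormallyEtale (FractionRing (MvPolynomial ι k)) K :=
    Algebra.FormallyEtale.of_isSeparable _ K
  have : Algebra.FormallyEtale (MvPolynomial ι k) (FractionRing (MvPolynomial ι k)) :=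
    .of_isLocalization (nonZeroDivisors _)
  have : Algebra.FormallyEtale (MvPolynomial ι k) K :=
    .comp _ (FractionRing (MvPolynomial ι k)) _
  obtain ⟨D, hD⟩ := exists_derivation_of_formallyEtale (MvPolynomial.mkDerivation k w)
  refine ⟨D, fun i => ?_⟩
  have := hD (MvPolynomial.X i)
  rwa [hmap, MvPolynomial.aeval_X, MvPolynomial.mkDerivation_X] at this

/-- Derivations take arbitrary values on algebraically independent elements. -/
theorem exists_derivation_of_algebraicIndependent {ι k K : Type*} [Field k] [CharZero k]
    [Field K] [Algebra k K] {x : ι → K} (hx : AlgebraicIndependent k x) (w : ι → K) :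
    ∃ D : Derivation k K K, ∀ i, D (x i) = w i := by
  classical
  obtain ⟨s, hs, hb⟩ := exists_isTranscendenceBasis_superset ((algebraicIndependent_subtype_range hx.injective).2 hx)
  obtain ⟨D, hD⟩ := exists_derivation_of_isTranscendenceBasis hb
    fun y => if h : ∃ i, x i = y then w h.choose else 0
  refine ⟨D, fun i => ?_⟩
  have h : ∃ j, x j = x i := ⟨i, rfl⟩
  have := hD ⟨x i, hs ⟨i, rfl⟩⟩
  simp only [h, dite_true] at this
  rw [this, hx.injective h.choose_spec]

theorem derivation_aeval {ι k K : Type*} [Fintype ι] [CommRing k] [CommRing K] [Algebra k K]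
    (D : Derivation k K K) (x : ι → K) (p : MvPolynomial ι k) :
    D (MvPolynomial.aeval x p) =
      ∑ i, MvPolynomial.aeval x (MvPolynomial.pderiv i p) * D (x i) := by
  classical
  induction p using MvPolynomial.induction_on with
  | C a => simp
  | add p q hp hq => simp [hp, hq, add_mul, Finset.sum_add_distrib]
  | mul_X p j hp =>
    simp only [map_mul, MvPolynomial.aeval_X, Derivation.leibniz, hp, smul_eq_mul, map_add,
      MvPolynomial.pderiv_X, Pi.single_apply, add_mul, Finset.sum_add_distrib, Finset.mul_sum]
    congr 1
    · rw [Finset.sum_eq_single j] <;> simp +contextual [eq_comm]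
    · exact Finset.sum_congr rfl fun _ _ => by ring

/-- The logarithmic derivative turns products into sums and kills constants. -/
theorem derivation_zpow_prod_div {ι k K : Type*} [CommRing k] [Field K] [Algebra k K]
    (D : Derivation k K K) (s : Finset ι) (x : ι → K) (hx : ∀ i ∈ s, x i ≠ 0) (e : ι → ℤ) (a : k)
    (ha : algebraMap k K a ≠ 0) :
    D (algebraMap k K a * ∏ i ∈ s, x i ^ e i) / (algebraMap k K a * ∏ i ∈ s, x i ^ e i) =
      ∑ i ∈ s, (e i : K) * D (x i) / x i := by
  classical
  induction s using Finset.induction_on with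
  | empty => simp
  | insert i s hi ih =>
    have hxi : x i ≠ 0 := hx i (by simp)
    have ih' := ih fun j hj => hx j (by simp [hj])
    have hp : algebraMap k K a * ∏ i ∈ s, x i ^ e i ≠ 0 :=
      mul_ne_zero ha (Finset.prod_ne_zero_iff.2 fun j hj => zpow_ne_zero _ (hx j (by simp [hj])))
    rw [Finset.prod_insert hi, Finset.sum_insert hi, ← ih', mul_left_comm, Derivation.leibniz,
      Derivation.leibniz_zpow]
    set p := algebraMap k K a * ∏ i ∈ s, x i ^ e i
    have hz : x i ^ e i = x i ^ (e i - 1) * x i := by rw [← zpow_add_one₀ hxi, sub_add_cancel]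
    have hz0 : x i ^ (e i - 1) ≠ 0 := zpow_ne_zero _ hxi
    rw [hz]
    simp only [smul_eq_mul, zsmul_eq_mul]
    field_simp
    ring

/-! ### Degrees, divisibility and residues of polynomials -/

open MvPolynomial
open scoped LinearAlgebra.Projectivization

/-- With the next two lemmas: a prime polynomial has a non-zero partial derivative in characteristic
zero, and does not divide it, for degree reasons. -/
theorem totalDegree_pderiv_lt {σ k : Type*} [CommSemiring k] {p : MvPolynomial σ k}
    (hp : 0 < p.totalDegree) (i : σ) : (pderiv i p).totalDegree < p.totalDegree := by
  rw [totalDegree, Finset.sup_lt_iff hp]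
  intro s hs
  rw [mem_support_iff, coeff_pderiv] at hs
  have h := le_totalDegree (mem_support_iff.2 (left_ne_zero_of_mul hs))
  rw [Finsupp.sum_add_index' (by simp) (by simp)] at h
  simp at h
  omega

theorem eq_zero_of_dvd_of_totalDegree_lt {σ k : Type*} [CommRing k] [IsDomain k]
    {p q : MvPolynomial σ k} (h : p ∣ q) (hd : q.totalDegree < p.totalDegree) : q = 0 := by
  obtain ⟨r, rfl⟩ := h
  by_contra h0
  rw [totalDegree_mul_of_isDomain (left_ne_zero_of_mul h0) (right_ne_zero_of_mul h0)] at hd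
  omega

theorem totalDegree_eq_zero_of_forall_pderiv_eq_zero {σ k : Type*} [CommRing k] [IsDomain k]
    [CharZero k] {p : MvPolynomial σ k} (h : ∀ i, pderiv i p = 0) : p.totalDegree = 0 := by
  classical
  rw [totalDegree_eq_zero_iff]
  intro s hs i
  by_contra hi
  have h1 : s = (s - Finsupp.single i 1) + Finsupp.single i 1 :=
    (tsub_add_cancel_of_le (by simpa [Nat.one_le_iff_ne_zero] using hi)).symm
  have h2 := congrArg (coeff (s - Finsupp.single i 1)) (h i)
  rw [coeff_pderiv, ← h1, coeff_zero, mul_eq_zero] at h2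
  rcases h2 with h2 | h2
  · exact (mem_support_iff.1 hs) h2
  · norm_cast at h2

theorem totalDegree_pos_of_prime {σ k : Type*} [Field k] {p : MvPolynomial σ k} (hp : Prime p) :
    0 < p.totalDegree := by
  by_contra h
  have h0 : p.totalDegree = 0 := by omega
  rw [totalDegree_eq_zero_iff_eq_C] at h0
  refine hp.not_isUnit ?_
  have : coeff 0 p ≠ 0 := fun hc => hp.ne_zero (by rw [h0, hc, C_0])
  rw [h0]
  exact (IsUnit.mk0 _ this).map C

/-- If a sum of fractions with pairwise coprime prime denominators vanishes, then so does each
residue. -/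
theorem prime_dvd_of_sum_div_eq_zero {R K : Type*} [CommRing R] [IsDomain R] [Field K]
    [Algebra R K] [IsFractionRing R K] (H : Finset R) (hp : ∀ h ∈ H, Prime h)
    (hH : ∀ h ∈ H, ∀ h' ∈ H, Associated h h' → h = h') (p : R → R)
    (hsum : ∑ h ∈ H, algebraMap R K (p h) / algebraMap R K h = 0) : ∀ h ∈ H, h ∣ p h := by
  classical
  have hinj := IsFractionRing.injective R K
  have h0 : ∀ h ∈ H, algebraMap R K h ≠ 0 := fun h hh =>
    (map_ne_zero_iff _ hinj).2 (hp h hh).ne_zero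
  have hpoly : ∑ h ∈ H, p h * ∏ h' ∈ H.erase h, h' = 0 := by
    apply hinj
    rw [map_zero, map_sum, ← mul_zero (∏ h ∈ H, algebraMap R K h), ← hsum, Finset.mul_sum]
    refine Finset.sum_congr rfl fun h hh => ?_
    rw [← Finset.mul_prod_erase H _ hh, map_mul, map_prod]
    field_simp [h0 h hh]
  intro h hh
  -- After clearing denominators, every summand other than that of `h` contains the factor `h`.
  have h1 : h ∣ p h * ∏ h' ∈ H.erase h, h' := by
    rw [← Finset.add_sum_erase H _ hh] at hpoly
    rw [eq_neg_of_add_eq_zero_left hpoly, dvd_neg]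
    refine Finset.dvd_sum fun g hg => Dvd.dvd.mul_left (Finset.dvd_prod_of_mem _ ?_) _
    simp only [Finset.mem_erase] at hg ⊢
    exact ⟨hg.1.symm, hh⟩
  refine ((hp h hh).dvd_or_dvd h1).resolve_right fun h2 => ?_
  obtain ⟨g, hg, hgd⟩ := ((hp h hh).dvd_finsetProd_iff _).1 h2
  rw [Finset.mem_erase] at hg
  exact hg.1 (hH h hh g hg.2 ((hp h hh).associated_of_dvd (hp g hg.2) hgd)).symm

/-- Simultaneous factorization of finitely many non-zero elements. -/
theorem exists_prime_factorization {ι R : Type*} [Fintype ι] [CommRing R] [IsDomain R]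
    [UniqueFactorizationMonoid R] (f : ι → R) (hf : ∀ i, f i ≠ 0) :
    ∃ (H : Finset R) (a : ι → Rˣ) (e : ι → R → ℕ), (∀ h ∈ H, Prime h) ∧
      (∀ h ∈ H, ∀ h' ∈ H, Associated h h' → h = h') ∧ ∀ i, f i = a i * ∏ h ∈ H, h ^ e i h := by
  classical
  let : StrongNormalizationMonoid R := Classical.choice inferInstance
  open UniqueFactorizationMonoid in
  have hu : ∀ i, ∃ a : Rˣ, f i = a * (normalizedFactors (f i)).prod := fun i => by
    obtain ⟨a, ha⟩ := prod_normalizedFactors (hf i)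
    exact ⟨a, by rw [mul_comm, ha]⟩
  choose a ha using hu
  refine ⟨Finset.univ.biUnion fun i => (UniqueFactorizationMonoid.normalizedFactors (f i)).toFinset,
    a, fun i h => (UniqueFactorizationMonoid.normalizedFactors (f i)).count h, ?_, ?_, ?_⟩
  · intro h hh
    simp only [Finset.mem_biUnion, Multiset.mem_toFinset] at hh
    obtain ⟨i, -, hi⟩ := hh
    exact UniqueFactorizationMonoid.prime_of_normalized_factor h hi
  · intro h hh h' hh' hass
    simp only [Finset.mem_biUnion, Multiset.mem_toFinset] at hh hh'
    obtain ⟨i, -, hi⟩ := hh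
    obtain ⟨j, -, hj⟩ := hh'
    rw [← UniqueFactorizationMonoid.normalize_normalized_factor h hi,
      ← UniqueFactorizationMonoid.normalize_normalized_factor h' hj]
    exact normalize_eq_normalize hass.dvd hass.symm.dvd
  · intro i
    conv_lhs => rw [ha i]
    rw [Finset.prod_multiset_count]
    congr 1
    refine Finset.prod_subset (fun h hh => Finset.mem_biUnion.2 ⟨i, Finset.mem_univ _, hh⟩) ?_
    intro h _ hh
    rw [Multiset.mem_toFinset] at hh
    simp [Multiset.count_eq_zero_of_notMem hh]

/-! ### Rational maps on projective space and their generic values -/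

theorem aeval_mul_of_isHomogeneous {k K : Type*} {σ : Type*} [CommRing k] [CommRing K] [Algebra k K]
    {d : ℕ} {P : MvPolynomial σ k} (hP : P.IsHomogeneous d) (a : K) (v : σ → K) :
    aeval (fun i => a * v i) P = a ^ d * aeval v P := by
  rw [aeval_def, aeval_def, eval₂_eq, eval₂_eq, Finset.mul_sum]
  refine Finset.sum_congr rfl fun s hs => ?_
  have hd : ∑ i ∈ s.support, s i = d := (hP.degree_eq_sum_deg_support hs).symm
  simp only [mul_pow, Finset.prod_mul_distrib, Finset.prod_pow_eq_pow_sum, hd]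
  ring

theorem exists_eval_rep_ne_zero {k d : ℕ} (hk : 1 ≤ k) {P : MvPolynomial (Fin k) ℂ}
    (hP : P.IsHomogeneous d) (h0 : P ≠ 0) : ∃ u : ℙ ℂ (Fin k → ℂ), eval u.rep P ≠ 0 := by
  -- The extra factor forces the point found below to be non-zero, even when `P` is constant.
  have h1 : P * X ⟨0, hk⟩ ≠ 0 := mul_ne_zero h0 (X_ne_zero _)
  obtain ⟨v, hv⟩ : ∃ v, eval v (P * X ⟨0, hk⟩) ≠ 0 := by
    by_contra! h
    exact h1 (funext fun v => by rw [h v, map_zero])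
  rw [map_mul, eval_X] at hv
  have hv0 : v ≠ 0 := fun h => right_ne_zero_of_mul hv (by rw [h]; rfl)
  obtain ⟨a, ha⟩ := Projectivization.exists_smul_eq_mk_rep ℂ v hv0
  refine ⟨Projectivization.mk ℂ v hv0, ?_⟩
  rw [← ha, Units.smul_def, eval_smul_of_isHomogeneous hP]
  exact mul_ne_zero (pow_ne_zero _ a.ne_zero) (left_ne_zero_of_mul hv)

theorem eq_zero_of_genericallyOnProj {k d d' : ℕ} (hk : 1 ≤ k) {P A : MvPolynomial (Fin k) ℂ}
    (hP : P.IsHomogeneous d) (h0 : P ≠ 0) (hA : A.IsHomogeneous d')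
    (h : ∀ u : ℙ ℂ (Fin k → ℂ), eval u.rep P ≠ 0 → eval u.rep A = 0) : A = 0 := by
  by_contra hA0
  obtain ⟨u, hu⟩ := exists_eval_rep_ne_zero hk (hP.mul hA) (mul_ne_zero h0 hA0)
  rw [map_mul] at hu
  exact right_ne_zero_of_mul hu (h u (left_ne_zero_of_mul hu))

/-- The numerator of the composite of a polynomial with a rational map, over the denominator
`f_0 ^ deg Q`. -/
noncomputable def ProjToAff.pullback {k m : ℕ} (φ : ProjToAff k m) (Q : MvPolynomial (Fin m) ℂ) :
    MvPolynomial (Fin k) ℂ :=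
  ∑ s ∈ Q.support, C (coeff s Q) *
    (φ.den ^ (Q.totalDegree - s.sum fun _ e => e) * ∏ j ∈ s.support, φ.num j ^ s j)

theorem ProjToAff.pullback_isHomogeneous {k m : ℕ} (φ : ProjToAff k m)
    (Q : MvPolynomial (Fin m) ℂ) : (φ.pullback Q).IsHomogeneous (φ.deg * Q.totalDegree) := by
  refine IsHomogeneous.sum _ _ _ fun s hs => ?_
  have hle : (s.sum fun _ e => e) ≤ Q.totalDegree := le_totalDegree hs
  have hd : φ.deg * Q.totalDegree = 0 + (φ.deg * (Q.totalDegree - s.sum fun _ e => e) +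
      ∑ j ∈ s.support, φ.deg * s j) := by
    rw [← Finset.mul_sum, ← mul_add, zero_add]
    congr 1
    exact (tsub_add_cancel_of_le hle).symm
  rw [hd]
  exact (isHomogeneous_C _ _).mul ((φ.den_homogeneous.pow _).mul
    (IsHomogeneous.prod _ _ _ fun j _ => (φ.num_homogeneous j).pow _))

/-- The ring homomorphism is left arbitrary so that one computation serves both evaluation at a
point and the embedding into the function field. -/
theorem ProjToAff.map_pullback {k m : ℕ} (φ : ProjToAff k m) {F : Type*} [Field F]
    (f : MvPolynomial (Fin k) ℂ →+* F) (hf : f φ.den ≠ 0) (Q : MvPolynomial (Fin m) ℂ) :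
    f (φ.pullback Q) =
      f φ.den ^ Q.totalDegree * eval₂ (f.comp C) (fun j => f (φ.num j) / f φ.den) Q := by
  rw [ProjToAff.pullback, map_sum, eval₂_eq, Finset.mul_sum]
  refine Finset.sum_congr rfl fun s hs => ?_
  have hle : (s.sum fun _ e => e) ≤ Q.totalDegree := le_totalDegree hs
  simp only [map_mul, map_pow, map_prod, div_pow, Finset.prod_div_distrib,
    Finset.prod_pow_eq_pow_sum, RingHom.comp_apply]
  rw [show ∑ i ∈ s.support, s i = s.sum fun _ e => e from rfl]
  have hpow : f φ.den ^ Q.totalDegree = f φ.den ^ (Q.totalDegree - s.sum fun _ e => e) *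
      f φ.den ^ (s.sum fun _ e => e) := by rw [← pow_add, tsub_add_cancel_of_le hle]
  rw [hpow]
  field_simp

theorem ProjToAff.eval_pullback {k m : ℕ} (φ : ProjToAff k m) {u : ℙ ℂ (Fin k → ℂ)}
    (hu : φ.DefinedAt u) (Q : MvPolynomial (Fin m) ℂ) :
    eval u.rep (φ.pullback Q) = eval u.rep φ.den ^ Q.totalDegree * eval (φ.value u) Q := by
  rw [φ.map_pullback (eval u.rep) hu Q]
  congr 1
  rw [← eval₂_id]
  congr 1
  ext; simp

section generic

variable {k m : ℕ} (K : Type*) [Field K] [Algebra (MvPolynomial (Fin k) ℂ) K]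
  [IsFractionRing (MvPolynomial (Fin k) ℂ) K] [Algebra ℂ K]
  [IsScalarTower ℂ (MvPolynomial (Fin k) ℂ) K] (φ : ProjToAff k m)

/-- The generic value `(f_1 / f_0, …, f_m / f_0)` of a rational map, in the field of rational
functions. -/
noncomputable def ProjToAff.generic : Fin m → K := fun j =>
  algebraMap (MvPolynomial (Fin k) ℂ) K (φ.num j) / algebraMap (MvPolynomial (Fin k) ℂ) K φ.den

/-- The set of values of a rational map. -/
def ProjToAff.image : Set (Fin m → ℂ) := {y | ∃ u, φ.DefinedAt u ∧ φ.value u = y}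

omit [IsScalarTower ℂ (MvPolynomial (Fin k) ℂ) K] [Algebra ℂ K] in
theorem ProjToAff.algebraMap_den_ne_zero :
    algebraMap (MvPolynomial (Fin k) ℂ) K φ.den ≠ 0 :=
  (map_ne_zero_iff _ (IsFractionRing.injective _ K)).2 φ.den_ne_zero

theorem ProjToAff.algebraMap_pullback (Q : MvPolynomial (Fin m) ℂ) :
    algebraMap (MvPolynomial (Fin k) ℂ) K (φ.pullback Q) =
      algebraMap (MvPolynomial (Fin k) ℂ) K φ.den ^ Q.totalDegree * aeval (φ.generic K) Q := by
  rw [φ.map_pullback _ (φ.algebraMap_den_ne_zero K) Q, aeval_def,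
    IsScalarTower.algebraMap_eq ℂ (MvPolynomial (Fin k) ℂ) K]
  rfl

theorem ProjToAff.aeval_generic_eq_zero_iff (Q : MvPolynomial (Fin m) ℂ) :
    aeval (φ.generic K) Q = 0 ↔ φ.pullback Q = 0 := by
  rw [← map_eq_zero_iff _ (IsFractionRing.injective (MvPolynomial (Fin k) ℂ) K),
    φ.algebraMap_pullback K Q, mul_eq_zero,
    or_iff_right (pow_ne_zero _ (φ.algebraMap_den_ne_zero K))]

variable {K φ} (hk : 1 ≤ k)
include hk

/-- The numerator of Q ∘ φ is homogeneous, so vanishing wherever the denominator does not vanish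
makes it zero. This passes from points to the function field. -/
theorem ProjToAff.mem_vanishingIdeal_image_iff {Q : MvPolynomial (Fin m) ℂ} :
    Q ∈ vanishingIdeal ℂ φ.image ↔ aeval (φ.generic K) Q = 0 := by
  rw [φ.aeval_generic_eq_zero_iff K]
  constructor
  · intro h
    refine eq_zero_of_genericallyOnProj hk φ.den_homogeneous φ.den_ne_zero
      (φ.pullback_isHomogeneous Q) fun u hu => ?_
    rw [φ.eval_pullback hu Q]
    have := h (φ.value u) ⟨u, hu, rfl⟩
    rw [aeval_eq_eval] at this
    rw [this, mul_zero]
  · rintro h y ⟨u, hu, rfl⟩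
    have := φ.eval_pullback hu Q
    rw [h, map_zero, zero_eq_mul, or_iff_right (pow_ne_zero _ hu)] at this
    rwa [aeval_eq_eval]

theorem ProjToAff.vanishingIdeal_image :
    vanishingIdeal ℂ φ.image = RingHom.ker (aeval (φ.generic K) : _ →ₐ[ℂ] K) := by
  ext Q
  rw [ProjToAff.mem_vanishingIdeal_image_iff (K := K) hk, RingHom.mem_ker]

theorem ProjToAff.mem_zariskiClosure_image_iff {y : Fin m → ℂ} :
    y ∈ zariskiClosure φ.image ↔
      ∀ Q : MvPolynomial (Fin m) ℂ, aeval (φ.generic K) Q = 0 → eval y Q = 0 := by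
  rw [zariskiClosure, ProjToAff.vanishingIdeal_image (K := K) hk, mem_zeroLocus_iff]
  simp [RingHom.mem_ker, aeval_eq_eval]

omit hk in
theorem ProjToAff.image_subset_zariskiClosure : φ.image ⊆ zariskiClosure φ.image :=
  zeroLocus_vanishingIdeal_le _

theorem ProjToAff.exists_mem_zariskiClosure_image {Q : MvPolynomial (Fin m) ℂ}
    (hQ : aeval (φ.generic K) Q ≠ 0) : ∃ y ∈ zariskiClosure φ.image, eval y Q ≠ 0 := by
  by_contra! h
  refine hQ ((ProjToAff.mem_vanishingIdeal_image_iff hk).1 fun y hy => ?_)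
  rw [aeval_eq_eval]
  exact h y (φ.image_subset_zariskiClosure hy)

omit hk

/-- `γ ∘ φ` is the identity at the generic point. -/
structure IsGenericLeftInverse (K : Type*) [Field K] [Algebra (MvPolynomial (Fin k) ℂ) K]
    [Algebra ℂ K] (γ : AffToProj m k) (φ : ProjToAff k m) : Prop where
  parallel : ∀ i j, aeval (φ.generic K) (γ.coord i) * algebraMap (MvPolynomial (Fin k) ℂ) K (X j) =
    aeval (φ.generic K) (γ.coord j) * algebraMap (MvPolynomial (Fin k) ℂ) K (X i)
  ne_zero : ∃ i, aeval (φ.generic K) (γ.coord i) ≠ 0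

variable {γ : AffToProj m k}

/-- Clearing denominators crosswise turns proportionality over `K` into a polynomial identity, which
can be evaluated at points. -/
theorem parallel_iff (i j : Fin k) :
    aeval (φ.generic K) (γ.coord i) * algebraMap (MvPolynomial (Fin k) ℂ) K (X j) =
      aeval (φ.generic K) (γ.coord j) * algebraMap (MvPolynomial (Fin k) ℂ) K (X i) ↔
    φ.den ^ (γ.coord j).totalDegree * φ.pullback (γ.coord i) * X j -
      φ.den ^ (γ.coord i).totalDegree * φ.pullback (γ.coord j) * X i = 0 := by
  rw [← map_eq_zero_iff _ (IsFractionRing.injective (MvPolynomial (Fin k) ℂ) K)]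
  simp only [map_sub, map_mul, map_pow, φ.algebraMap_pullback K]
  have h := φ.algebraMap_den_ne_zero K
  rw [← sub_eq_zero]
  have h2 : algebraMap (MvPolynomial (Fin k) ℂ) K φ.den ^ (γ.coord i).totalDegree *
      algebraMap (MvPolynomial (Fin k) ℂ) K φ.den ^ (γ.coord j).totalDegree ≠ 0 :=
    mul_ne_zero (pow_ne_zero _ h) (pow_ne_zero _ h)
  rw [← mul_eq_zero_iff_left h2]
  ring_nf

/-- The identity holds wherever both maps are defined, not just on some unspecified open set; this
later excludes a second preimage. -/
theorem IsGenericLeftInverse.value_eq (h : IsGenericLeftInverse K γ φ) {u : ℙ ℂ (Fin k → ℂ)}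
    (hu : φ.DefinedAt u) (hy : γ.vec (φ.value u) ≠ 0) : γ.value (φ.value u) hy = u := by
  have hp : ∀ i j, γ.vec (φ.value u) i * u.rep j = γ.vec (φ.value u) j * u.rep i := fun i j => by
    have h1 := congrArg (eval u.rep) ((parallel_iff i j).1 (h.parallel i j))
    simp only [map_sub, map_mul, map_pow, φ.eval_pullback hu, map_zero, eval_X] at h1
    have h2 : eval u.rep φ.den ^ (γ.coord i).totalDegree *
      eval u.rep φ.den ^ (γ.coord j).totalDegree ≠ 0 :=
        mul_ne_zero (pow_ne_zero _ hu) (pow_ne_zero _ hu)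
    refine mul_left_cancel₀ h2 ?_
    simp only [AffToProj.vec]
    linear_combination h1
  obtain ⟨i, hi⟩ := Function.ne_iff.1 hy
  simp only [Pi.zero_apply] at hi
  conv_rhs => rw [← u.mk_rep]
  refine ((Projectivization.mk_eq_mk_iff' ℂ _ _ u.rep_nonzero hy).2
    ⟨u.rep i / γ.vec (φ.value u) i, ?_⟩).symm
  ext j
  simp only [Pi.smul_apply, smul_eq_mul]
  field_simp
  linear_combination - hp i j

include hk in
-- On the closure of the image, a left inverse is automatically two-sided. As γ(g) = c · u,
-- homogeneity gives f_j(γ(g)) = c^deg · f_j(u), so f_j ∘ γ − y_j · (f_0 ∘ γ) vanishes at g and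
-- hence on the closure.
theorem IsGenericLeftInverse.mutuallyInverse (h : IsGenericLeftInverse K γ φ) :
    MutuallyInverse (zariskiClosure φ.image) γ φ := by
  obtain ⟨i₀, hi₀⟩ := h.ne_zero
  have hX : algebraMap (MvPolynomial (Fin k) ℂ) K (X i₀) ≠ 0 :=
    (map_ne_zero_iff _ (IsFractionRing.injective _ K)).2 (X_ne_zero _)
  have hden := φ.algebraMap_den_ne_zero K
  set c : K := aeval (φ.generic K) (γ.coord i₀) / algebraMap (MvPolynomial (Fin k) ℂ) K (X i₀)
    with hc
  have hc0 : c ≠ 0 := div_ne_zero hi₀ hX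
  have hvec : (fun i => aeval (φ.generic K) (γ.coord i)) =
      fun i => c * algebraMap (MvPolynomial (Fin k) ℂ) K (X i) := by
    ext i
    rw [hc]
    field_simp
    exact h.parallel i i₀
  have hbind : ∀ {P : MvPolynomial (Fin k) ℂ}, P.IsHomogeneous φ.deg →
      aeval (φ.generic K) (bind₁ γ.coord P) =
        c ^ φ.deg * algebraMap (MvPolynomial (Fin k) ℂ) K P := fun {P} hP => by
    rw [aeval_bind₁, hvec, aeval_mul_of_isHomogeneous hP]
    congr 1
    rw [← Function.comp_def, aeval_algebraMap_apply]
    simp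
  have hbv : ∀ y (P : MvPolynomial (Fin k) ℂ), eval y (bind₁ γ.coord P) = eval (γ.vec y) P :=
    fun y P => by
      rw [← aeval_eq_eval, aeval_bind₁, aeval_eq_eval]
      rfl
  constructor
  · refine ⟨γ.coord i₀ * bind₁ γ.coord φ.den, ?_, fun y hy hP => ?_⟩
    · refine ProjToAff.exists_mem_zariskiClosure_image (K := K) hk ?_
      rw [map_mul, hbind φ.den_homogeneous]
      exact mul_ne_zero hi₀ (mul_ne_zero (pow_ne_zero _ hc0) hden)
    · rw [map_mul, hbv] at hP
      have hv : γ.vec y ≠ 0 := fun h0 => left_ne_zero_of_mul hP (congrFun h0 i₀)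
      have hd := right_ne_zero_of_mul hP
      refine ⟨hv, (φ.definedAt_mk _ hv).2 hd, ?_⟩
      rw [AffToProj.value, φ.value_mk]
      ext j
      rw [div_eq_iff hd]
      have := (ProjToAff.mem_zariskiClosure_image_iff (K := K) hk).1 hy
        (bind₁ γ.coord (φ.num j) - X j * bind₁ γ.coord φ.den) (by
          rw [map_sub, map_mul, hbind φ.den_homogeneous, hbind (φ.num_homogeneous j), aeval_X,
            ProjToAff.generic]
          field_simp
          ring)
      rw [map_sub, map_mul, hbv, hbv, eval_X] at this
      exact sub_eq_zero.1 this
  · refine ⟨_, _, φ.den_homogeneous.mul (φ.pullback_isHomogeneous (γ.coord i₀)),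
      exists_eval_rep_ne_zero hk (φ.den_homogeneous.mul (φ.pullback_isHomogeneous (γ.coord i₀)))
        (mul_ne_zero φ.den_ne_zero ?_), fun u hu => ?_⟩
    · rwa [Ne, ← φ.aeval_generic_eq_zero_iff K]
    · rw [map_mul] at hu
      have hd : φ.DefinedAt u := left_ne_zero_of_mul hu
      rw [φ.eval_pullback hd] at hu
      have hv : γ.vec (φ.value u) ≠ 0 := fun h0 =>
        right_ne_zero_of_mul (right_ne_zero_of_mul hu) (congrFun h0 i₀)
      exact ⟨hd, φ.image_subset_zariskiClosure ⟨u, hd, rfl⟩, hv, h.value_eq hd hv⟩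

include hk in
theorem MutuallyInverse.isGenericLeftInverse {S : Set (Fin m → ℂ)} (h : MutuallyInverse S γ φ) :
    IsGenericLeftInverse K γ φ := by
  obtain ⟨d, P, hP, ⟨u₀, hu₀⟩, hu⟩ := h.2
  have hP0 : P ≠ 0 := fun h0 => hu₀ (by rw [h0, map_zero])
  refine ⟨fun i j => (parallel_iff i j).2 ?_, ?_⟩
  · have hom : ∀ i j, (φ.den ^ (γ.coord j).totalDegree * φ.pullback (γ.coord i) *
        X j).IsHomogeneous (φ.deg * (γ.coord j).totalDegree + φ.deg * (γ.coord i).totalDegree + 1) :=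
      fun i j => ((φ.den_homogeneous.pow _).mul (φ.pullback_isHomogeneous _)).mul
        (isHomogeneous_X _ _)
    have hom2 := hom j i
    rw [add_comm (φ.deg * (γ.coord i).totalDegree)] at hom2
    refine eq_zero_of_genericallyOnProj hk hP hP0 ((hom i j).sub hom2) fun u hPu => ?_
    obtain ⟨hd, -, hv, heq⟩ := hu u hPu
    obtain ⟨a, ha⟩ := Projectivization.exists_smul_eq_mk_rep ℂ _ hv
    rw [show Projectivization.mk ℂ _ hv = u from heq] at ha
    have h1 : ∀ i, u.rep i = a * eval (φ.value u) (γ.coord i) := fun i => by rw [← ha]; rfl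
    simp only [map_sub, map_mul, map_pow, φ.eval_pullback hd, eval_X]
    rw [h1 i, h1 j]
    ring
  · by_contra! h0
    obtain ⟨hd, -, hv, -⟩ := hu u₀ hu₀
    refine hv (funext fun i => ?_)
    have h1 := φ.eval_pullback hd (γ.coord i)
    rw [(φ.aeval_generic_eq_zero_iff K _).1 (h0 i), map_zero, zero_eq_mul,
      or_iff_right (pow_ne_zero _ hd)] at h1
    exact h1

include hk in
-- The image of φ is dense in S: it contains the points of S where some P, not identically zero on
-- S, does not vanish. Primality then removes the factor P.
theorem MutuallyInverse.mem_vanishingIdeal_iff {S : Set (Fin m → ℂ)} (h : MutuallyInverse S γ φ)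
    (hS : (vanishingIdeal ℂ S).IsPrime) {Q : MvPolynomial (Fin m) ℂ} :
    Q ∈ vanishingIdeal ℂ S ↔ aeval (φ.generic K) Q = 0 := by
  constructor
  · intro hQ
    obtain ⟨d, P, hP, ⟨u₀, hu₀⟩, hu⟩ := h.2
    have hP0 : P ≠ 0 := fun h0 => hu₀ (by rw [h0, map_zero])
    rw [φ.aeval_generic_eq_zero_iff K]
    refine eq_zero_of_genericallyOnProj hk hP hP0 (φ.pullback_isHomogeneous Q) fun u hPu => ?_
    obtain ⟨hd, hS, -⟩ := hu u hPu
    have := hQ _ hS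
    rw [aeval_eq_eval] at this
    rw [φ.eval_pullback hd, this, mul_zero]
  · intro hQ
    obtain ⟨P, ⟨y, hyS, hyP⟩, hP⟩ := h.1
    have hPQ : P * Q ∈ vanishingIdeal ℂ S := fun z hz => by
      rw [aeval_eq_eval, map_mul]
      by_cases hz0 : eval z P = 0
      · rw [hz0, zero_mul]
      · obtain ⟨hv, hd, heq⟩ := hP z hz hz0
        have := (ProjToAff.mem_vanishingIdeal_image_iff (K := K) hk).2 hQ z ⟨_, hd, heq⟩
        rw [aeval_eq_eval] at this
        rw [this, mul_zero]
    refine (hS.mem_or_mem hPQ).resolve_left fun h0 => hyP ?_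
    have := h0 y hyS
    rwa [aeval_eq_eval] at this

end generic

/-! ### Hypersurfaces and their minimal equations -/

theorem vanishingIdeal_zariskiClosure {m : ℕ} (V : Set (Fin m → ℂ)) :
    vanishingIdeal ℂ (zariskiClosure V) = vanishingIdeal ℂ V :=
  le_antisymm (vanishingIdeal_anti_mono (zeroLocus_vanishingIdeal_le V))
    (le_vanishingIdeal_zeroLocus _)

theorem IsMinimalEquation.vanishingIdeal_eq {m : ℕ} {Δ : MvPolynomial (Fin m) ℂ}
    {S : Set (Fin m → ℂ)} (h : IsMinimalEquation Δ S) : vanishingIdeal ℂ S = Ideal.span {Δ} := by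
  have hS : S = zeroLocus ℂ (Ideal.span {Δ}) := by
    rw [h.zeroSet, zeroLocus_span]
    ext x
    simp [aeval_eq_eval]
  rw [hS, vanishingIdeal_zeroLocus_eq_radical,
    ((Ideal.span_singleton_prime h.irreducible.ne_zero).2 h.irreducible.prime).radical]

theorem IsMinimalEquation.zariskiClosure_eq {m : ℕ} {Δ : MvPolynomial (Fin m) ℂ}
    {S : Set (Fin m → ℂ)} (h : IsMinimalEquation Δ S) : zariskiClosure S = S := by
  rw [zariskiClosure, h.vanishingIdeal_eq, zeroLocus_span, h.zeroSet]
  ext x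
  simp [aeval_eq_eval]

/-- If all relations between the `g_k` are multiples of `Δ`, then omitting a `g_k` whose variable
occurs in `Δ` leaves an algebraically independent family. -/
theorem algebraicIndependent_of_ker_eq_span {m : ℕ} {K : Type*} [Field K] [Algebra ℂ K]
    {g : Fin m → K} {Δ : MvPolynomial (Fin m) ℂ} (hker : ∀ Q, aeval g Q = 0 → Δ ∣ Q)
    {k₀ : Fin m} (h0 : pderiv k₀ Δ ≠ 0) :
    AlgebraicIndependent ℂ fun k : {k // k ≠ k₀} => g k := by
  classical
  rw [algebraicIndependent_iff]
  intro p hp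
  have h1 : Δ ∣ rename Subtype.val p := hker _ (by rw [aeval_rename]; exact hp)
  obtain ⟨q, hq⟩ := h1
  by_contra hp0
  have hr0 : rename (Subtype.val : {k // k ≠ k₀} → Fin m) p ≠ 0 :=
    (map_ne_zero_iff _ (rename_injective _ Subtype.val_injective)).2 hp0
  -- The renamed polynomial does not involve the variable k₀, whereas Δ does, and so does every
  -- non-zero multiple of Δ.
  have hr : degreeOf k₀ (rename (Subtype.val : {k // k ≠ k₀} → Fin m) p) = 0 := by
    rw [degreeOf_eq_sup, ← Nat.bot_eq_zero, Finset.sup_eq_bot_iff]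
    intro s hs
    obtain ⟨t, rfl, -⟩ := coeff_rename_ne_zero _ _ _ (mem_support_iff.1 hs)
    refine Finsupp.mapDomain_of_notMem_range _ _ ?_
    simp
  rw [hq] at hr hr0
  rw [degreeOf_mul_eq (left_ne_zero_of_mul hr0) (right_ne_zero_of_mul hr0)] at hr
  refine h0 (pderiv_eq_zero_of_notMem_vars fun hv => ?_)
  have := mem_vars_iff_degreeOf_ne_zero.1 hv
  omega

/-! ### The differential system of the logarithmic Gauss map -/

section logGauss

variable {m : ℕ} (K : Type*) [Field K] [Algebra (MvPolynomial (Fin m) ℂ) K]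
  [IsFractionRing (MvPolynomial (Fin m) ℂ) K] [Algebra ℂ K]
  [IsScalarTower ℂ (MvPolynomial (Fin m) ℂ) K]

/-- The system of differential equations `∑ k, u_k · d log g_k = 0` in the field of rational
functions: the parametrization `g` is inverse to the logarithmic Gauss map of its image. -/
structure IsLogGaussSection (g : Fin m → K) : Prop where
  ne_zero : ∀ k, g k ≠ 0
  sum_eq_zero : ∀ D : Derivation ℂ K K,
    ∑ k, algebraMap (MvPolynomial (Fin m) ℂ) K (X k) * (D (g k) / g k) = 0

variable {K} {g : Fin m → K} {φ : ProjToAff m m} {Δ : MvPolynomial (Fin m) ℂ}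

omit [IsFractionRing (MvPolynomial (Fin m) ℂ) K] [Algebra ℂ K]
  [IsScalarTower ℂ (MvPolynomial (Fin m) ℂ) K] in
theorem algebraMap_X_ne_zero [IsFractionRing (MvPolynomial (Fin m) ℂ) K] (k : Fin m) :
    algebraMap (MvPolynomial (Fin m) ℂ) K (X k) ≠ 0 :=
  (map_ne_zero_iff _ (IsFractionRing.injective _ K)).2 (X_ne_zero _)

omit [IsScalarTower ℂ (MvPolynomial (Fin m) ℂ) K] in
-- A derivation with value 1 on the first coordinate and 0 on the others would reduce the system to
-- u_1 / g_1 = 0. Hence the image is never dense in ℂ^m.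
theorem IsLogGaussSection.not_algebraicIndependent (hg : IsLogGaussSection K g) (hm : 1 ≤ m) :
    ¬ AlgebraicIndependent ℂ g := by
  intro hind
  obtain ⟨D, hD⟩ := exists_derivation_of_algebraicIndependent hind (Pi.single ⟨0, hm⟩ 1)
  have h := hg.sum_eq_zero D
  rw [Finset.sum_eq_single ⟨0, hm⟩] at h
  · rw [hD, Pi.single_eq_same] at h
    exact mul_ne_zero (algebraMap_X_ne_zero _) (div_ne_zero one_ne_zero (hg.ne_zero _)) h
  · intro k _ hk
    rw [hD, Pi.single_eq_of_ne hk, zero_div, mul_zero]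
  · simp

theorem logGauss_coord (Δ : MvPolynomial (Fin m) ℂ) (k : Fin m) :
    (logGauss Δ).coord k = X k * pderiv k Δ := rfl

omit [Algebra (MvPolynomial (Fin m) ℂ) K] [IsFractionRing (MvPolynomial (Fin m) ℂ) K]
  [IsScalarTower ℂ (MvPolynomial (Fin m) ℂ) K] in
theorem sum_logGauss_mul_eq_zero (hg : ∀ k, g k ≠ 0) (h0 : aeval g Δ = 0)
    (D : Derivation ℂ K K) :
    ∑ k, aeval g ((logGauss Δ).coord k) * (D (g k) / g k) = 0 := by
  have h := derivation_aeval D g Δ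
  rw [h0, map_zero] at h
  rw [h]
  refine Finset.sum_congr rfl fun k _ => ?_
  rw [logGauss_coord, map_mul, aeval_X]
  field_simp [hg k]

omit [IsScalarTower ℂ (MvPolynomial (Fin m) ℂ) K] in
theorem IsLogGaussSection.isGenericLeftInverse (hg : IsLogGaussSection K (φ.generic K))
    (hΔ : Irreducible Δ) (hker : ∀ Q, aeval (φ.generic K) Q = 0 ↔ Δ ∣ Q) :
    IsGenericLeftInverse K (logGauss Δ) φ := by
  classical
  have hpos := totalDegree_pos_of_prime hΔ.prime
  obtain ⟨k₀, hk₀⟩ : ∃ k, pderiv k Δ ≠ 0 := by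
    by_contra! h
    exact hpos.ne' (totalDegree_eq_zero_of_forall_pderiv_eq_zero h)
  set g := φ.generic K
  have hne : aeval g ((logGauss Δ).coord k₀) ≠ 0 := by
    rw [logGauss_coord, map_mul, aeval_X]
    exact mul_ne_zero (hg.ne_zero _) fun h =>
      hk₀ (eq_zero_of_dvd_of_totalDegree_lt ((hker _).1 h) (totalDegree_pderiv_lt hpos _))
  have hind := algebraicIndependent_of_ker_eq_span (fun Q => (hker Q).1) hk₀
  have key : ∀ j, aeval g ((logGauss Δ).coord j) * algebraMap (MvPolynomial (Fin m) ℂ) K (X k₀) =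
      aeval g ((logGauss Δ).coord k₀) * algebraMap (MvPolynomial (Fin m) ℂ) K (X j) := by
    intro j
    by_cases hj : j = k₀
    · rw [hj]
    -- The logarithmic derivatives along D are 1 at j, unknown at k₀ and 0 elsewhere. Eliminating
    -- the unknown from the two systems gives proportionality of the coordinates j and k₀.
    obtain ⟨D, hD⟩ := exists_derivation_of_algebraicIndependent hind (Pi.single ⟨j, hj⟩ (g j))
    have hsum : ∀ v : Fin m → K, ∑ k, v k * (D (g k) / g k) =
        v j + v k₀ * (D (g k₀) / g k₀) := by
      intro v
      rw [← Finset.sum_subset (Finset.subset_univ {j, k₀})]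
      · rw [Finset.sum_pair hj, hD ⟨j, hj⟩, Pi.single_eq_same, div_self (hg.ne_zero j), mul_one]
      · intro k _ hk
        simp only [Finset.mem_insert, Finset.mem_singleton, not_or] at hk
        rw [hD ⟨k, hk.2⟩, Pi.single_eq_of_ne (by simpa using hk.1), zero_div, mul_zero]
    have h1 := hg.sum_eq_zero D
    have h2 := sum_logGauss_mul_eq_zero hg.ne_zero ((hker Δ).2 dvd_rfl) D
    rw [hsum fun k => algebraMap (MvPolynomial (Fin m) ℂ) K (X k)] at h1
    rw [hsum fun k => aeval g ((logGauss Δ).coord k)] at h2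
    linear_combination algebraMap (MvPolynomial (Fin m) ℂ) K (X k₀) * h2 -
      aeval g ((logGauss Δ).coord k₀) * h1
  refine ⟨fun i j => ?_, k₀, hne⟩
  have hX := algebraMap_X_ne_zero (K := K) k₀
  refine mul_right_cancel₀ hX ?_
  linear_combination algebraMap (MvPolynomial (Fin m) ℂ) K (X j) * key i -
    algebraMap (MvPolynomial (Fin m) ℂ) K (X i) * key j

omit [IsScalarTower ℂ (MvPolynomial (Fin m) ℂ) K] in
theorem IsGenericLeftInverse.isLogGaussSection (h : IsGenericLeftInverse K (logGauss Δ) φ)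
    (h0 : aeval (φ.generic K) Δ = 0) : IsLogGaussSection K (φ.generic K) := by
  obtain ⟨i₀, hi₀⟩ := h.ne_zero
  have hX := algebraMap_X_ne_zero (m := m) (K := K)
  -- If g_k = 0, the k-th Gauss coordinate vanishes because of its factor y_k, while u_k ≠ 0,
  -- contradicting proportionality.
  have hne : ∀ k, φ.generic K k ≠ 0 := fun k hk => by
    have h1 := h.parallel i₀ k
    rw [logGauss_coord Δ k, map_mul, aeval_X, hk, zero_mul, zero_mul] at h1
    exact mul_ne_zero hi₀ (hX k) h1
  refine ⟨hne, fun D => ?_⟩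
  have h1 := sum_logGauss_mul_eq_zero hne h0 D
  refine mul_left_cancel₀ hi₀ ?_
  rw [mul_zero, ← mul_zero (algebraMap (MvPolynomial (Fin m) ℂ) K (X i₀)), ← h1,
    Finset.mul_sum, Finset.mul_sum]
  refine Finset.sum_congr rfl fun k _ => ?_
  linear_combination (D (φ.generic K k) / φ.generic K k) * h.parallel i₀ k

end logGauss

/-! ### Horn–Kapranov maps solve the system -/

section rows

variable {m : ℕ} {K : Type*} [Field K] [Algebra (MvPolynomial (Fin m) ℂ) K]
  [IsFractionRing (MvPolynomial (Fin m) ℂ) K] [Algebra ℂ K]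
  [IsScalarTower ℂ (MvPolynomial (Fin m) ℂ) K]

/-- The linear form with coefficients `r`, as a rational function. -/
noncomputable def rowForm (K : Type*) [Field K] [Algebra (MvPolynomial (Fin m) ℂ) K]
    (r : Fin m → ℤ) : K :=
  ∑ k, (r k : K) * algebraMap (MvPolynomial (Fin m) ℂ) K (X k)

omit [IsFractionRing (MvPolynomial (Fin m) ℂ) K] [Algebra ℂ K]
  [IsScalarTower ℂ (MvPolynomial (Fin m) ℂ) K] in
theorem algebraMap_linPoly {n : ℕ} (C : Matrix (Fin n) (Fin m) ℤ) (i : Fin n) :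
    algebraMap (MvPolynomial (Fin m) ℂ) K (linPoly C i) = rowForm K (C i) := by
  simp [linPoly, rowForm]

theorem generic_translate_hornKapranov {n : ℕ} {C : Matrix (Fin n) (Fin m) ℤ}
    (hC : IsHornMatrix C) (τ : Fin m → ℂˣ) (k : Fin m) :
    ((hornKapranov C hC).translate τ).generic K k =
      algebraMap ℂ K (τ k) * ∏ i, rowForm K (C i) ^ C i k := by
  have hr : ∀ i, rowForm K (C i) ≠ 0 := fun i => by
    rw [← algebraMap_linPoly]
    exact (map_ne_zero_iff _ (IsFractionRing.injective _ K)).2 (linPoly_ne_zero (hC.row_ne_zero i))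
  simp only [ProjToAff.generic, ProjToAff.translate, hornKapranov, map_mul, map_prod, map_pow,
    algebraMap_linPoly]
  rw [mul_div_assoc, ← Finset.prod_div_distrib, ← algebraMap_eq,
    ← IsScalarTower.algebraMap_apply]
  congr 1
  refine Finset.prod_congr rfl fun i _ => ?_
  rw [div_eq_iff (pow_ne_zero _ (hr i)), ← zpow_natCast, ← zpow_natCast, ← zpow_add₀ (hr i),
    Int.toNat_of_nonneg (neg_le_denExp C i k)]

theorem isLogGaussSection_hornKapranov {n : ℕ} {C : Matrix (Fin n) (Fin m) ℤ}
    (hC : IsHornMatrix C) (τ : Fin m → ℂˣ) :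
    IsLogGaussSection K (((hornKapranov C hC).translate τ).generic K) := by
  have hr : ∀ i, rowForm K (C i) ≠ 0 := fun i => by
    rw [← algebraMap_linPoly]
    exact (map_ne_zero_iff _ (IsFractionRing.injective _ K)).2 (linPoly_ne_zero (hC.row_ne_zero i))
  have hτ : ∀ k, algebraMap ℂ K (τ k) ≠ 0 := fun k => by simp
  refine ⟨fun k => ?_, fun D => ?_⟩
  · rw [generic_translate_hornKapranov]
    exact mul_ne_zero (hτ k) (Finset.prod_ne_zero_iff.2 fun i _ => zpow_ne_zero _ (hr i))
  · simp only [generic_translate_hornKapranov]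
    simp only [derivation_zpow_prod_div D Finset.univ (fun i => rowForm K (C i))
      (fun i _ => hr i) _ _ (hτ _), Finset.mul_sum]
    rw [Finset.sum_comm]
    -- Since ∑_k c_{ik} u_k = l_i, contraction with u cancels the denominator l_i.
    have h1 : ∀ i, ∑ k, algebraMap (MvPolynomial (Fin m) ℂ) K (X k) *
        ((C i k : K) * D (rowForm K (C i)) / rowForm K (C i)) = D (rowForm K (C i)) := fun i => by
      have : ∀ k, algebraMap (MvPolynomial (Fin m) ℂ) K (X k) *
          ((C i k : K) * D (rowForm K (C i)) / rowForm K (C i)) =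
          ((C i k : K) * algebraMap (MvPolynomial (Fin m) ℂ) K (X k)) *
          (D (rowForm K (C i)) / rowForm K (C i)) := fun k => by ring
      simp only [this]
      rw [← Finset.sum_mul]
      exact mul_div_cancel₀ _ (hr i)
    simp only [h1]
    rw [← map_sum]
    have : ∑ i, rowForm K (C i) = 0 := by
      simp only [rowForm]
      rw [Finset.sum_comm]
      refine Finset.sum_eq_zero fun k _ => ?_
      rw [← Finset.sum_mul, ← Int.cast_sum, hC.regular k, Int.cast_zero, zero_mul]
    rw [this, map_zero]

end rows

/-! ### Solutions of the system are monomials in linear forms -/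

section monomials

variable {m : ℕ} {K : Type*} [Field K] [Algebra (MvPolynomial (Fin m) ℂ) K]
  [IsFractionRing (MvPolynomial (Fin m) ℂ) K] [Algebra ℂ K]
  [IsScalarTower ℂ (MvPolynomial (Fin m) ℂ) K]

variable (K) in
omit [IsFractionRing (MvPolynomial (Fin m) ℂ) K] in
theorem algebraMap_C (a : ℂ) :
    algebraMap (MvPolynomial (Fin m) ℂ) K (C a) = algebraMap ℂ K a := by
  rw [← algebraMap_eq, ← IsScalarTower.algebraMap_apply]

theorem exists_prime_monomials {φ : ProjToAff m m} (hg : ∀ k, φ.generic K k ≠ 0) :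
    ∃ (H : Finset (MvPolynomial (Fin m) ℂ)) (t : Fin m → ℂˣ)
      (c : MvPolynomial (Fin m) ℂ → Fin m → ℤ), (∀ h ∈ H, Prime h) ∧
      (∀ h ∈ H, ∀ h' ∈ H, Associated h h' → h = h') ∧ ∀ k, φ.generic K k =
        algebraMap ℂ K (t k) * ∏ h ∈ H, algebraMap (MvPolynomial (Fin m) ℂ) K h ^ c h k := by
  have hinj := IsFractionRing.injective (MvPolynomial (Fin m) ℂ) K
  obtain ⟨H, a, e, hp, hH, hf⟩ := exists_prime_factorization
    -- The common denominator (`none`) and all numerators are factored over one set of primes; the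
    -- units that occur are constants.
    (fun o : Option (Fin m) => o.elim φ.den φ.num) (fun o => by
      cases o with
      | none => exact φ.den_ne_zero
      | some k => exact fun h => hg k (by
          rw [ProjToAff.generic, show φ.num k = 0 from h, map_zero, zero_div]))
  have hu : ∀ o, ∃ r : ℂˣ, (a o : MvPolynomial (Fin m) ℂ) = C (r : ℂ) := fun o => by
    obtain ⟨r, hr, h⟩ := isUnit_iff_eq_C_of_isReduced.1 (a o).isUnit
    exact ⟨hr.unit, h⟩
  choose r hr using hu
  refine ⟨H, fun k => r (some k) / r none, fun h k => (e (some k) h : ℤ) - e none h, hp, hH,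
    fun k => ?_⟩
  have hk := hf (some k)
  have hd := hf none
  simp only [Option.elim] at hk hd
  have h0 : ∀ h ∈ H, algebraMap (MvPolynomial (Fin m) ℂ) K h ≠ 0 := fun h hh =>
    (map_ne_zero_iff _ hinj).2 (hp h hh).ne_zero
  rw [ProjToAff.generic, hk, hd, hr, hr]
  simp only [map_mul, map_prod, map_pow, algebraMap_C, Units.val_div_eq_div_val, map_div₀]
  rw [mul_div_mul_comm, ← Finset.prod_div_distrib]
  congr 1
  refine Finset.prod_congr rfl fun h hh => ?_
  rw [zpow_sub₀ (h0 h hh), zpow_natCast, zpow_natCast]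

variable (K) in
omit [IsFractionRing (MvPolynomial (Fin m) ℂ) K] in
theorem derivation_algebraMap (D : Derivation ℂ K K) (p : MvPolynomial (Fin m) ℂ) :
    D (algebraMap (MvPolynomial (Fin m) ℂ) K p) =
      ∑ i, algebraMap (MvPolynomial (Fin m) ℂ) K (pderiv i p) *
        D (algebraMap (MvPolynomial (Fin m) ℂ) K (X i)) := by
  have h : ∀ q : MvPolynomial (Fin m) ℂ, algebraMap (MvPolynomial (Fin m) ℂ) K q =
      aeval (fun i => algebraMap (MvPolynomial (Fin m) ℂ) K (X i)) q := fun q => by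
    rw [← Function.comp_def, aeval_algebraMap_apply]
    simp
  rw [h p, derivation_aeval]
  simp only [← h]

variable (K) in
theorem exists_derivation_algebraMap_X (w : Fin m → K) :
    ∃ D : Derivation ℂ K K, ∀ i, D (algebraMap (MvPolynomial (Fin m) ℂ) K (X i)) = w i := by
  have : Algebra.FormallyEtale (MvPolynomial (Fin m) ℂ) K :=
    .of_isLocalization (nonZeroDivisors _)
  obtain ⟨D, hD⟩ := exists_derivation_of_formallyEtale (K := K) (mkDerivation ℂ w)
  exact ⟨D, fun i => by rw [hD, mkDerivation_X]⟩

theorem exists_eq_C_mul_of_dvd_linPoly {n : ℕ} {C' : Matrix (Fin n) (Fin m) ℤ} {i : Fin n}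
    (hi : C' i ≠ 0) {h : MvPolynomial (Fin m) ℂ} (hp : Prime h) (hd : h ∣ linPoly C' i) :
    ∃ b : ℂˣ, h = C (b : ℂ) * linPoly C' i := by
  obtain ⟨q, hq⟩ := hd
  have h0 := linPoly_ne_zero hi
  rw [hq] at h0
  have hdeg : (h * q).totalDegree = 1 := by
    rw [← hq]
    exact (linPoly_isHomogeneous C' i).totalDegree (linPoly_ne_zero hi)
  rw [totalDegree_mul_of_isDomain (left_ne_zero_of_mul h0) (right_ne_zero_of_mul h0)] at hdeg
  have hpos := totalDegree_pos_of_prime hp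
  have hq0 : q.totalDegree = 0 := by omega
  obtain ⟨a, rfl⟩ : ∃ a, q = C a := ⟨_, totalDegree_eq_zero_iff_eq_C.1 hq0⟩
  have hc : a ≠ 0 := fun hc => right_ne_zero_of_mul h0 (by rw [hc, C_0])
  refine ⟨(Units.mk0 a hc)⁻¹, ?_⟩
  rw [hq, mul_left_comm, ← C_mul]
  simp [hc]

/-- The irreducible factors with a non-zero exponent vector of a parametrization inverse to a
logarithmic Gauss map are linear forms with proportional coefficient vector. -/
theorem IsLogGaussSection.exists_eq_mul_rowForm {g : Fin m → K} (hg : IsLogGaussSection K g)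
    {H : Finset (MvPolynomial (Fin m) ℂ)} {t : Fin m → ℂˣ}
    {c : MvPolynomial (Fin m) ℂ → Fin m → ℤ} (hp : ∀ h ∈ H, Prime h)
    (hH : ∀ h ∈ H, ∀ h' ∈ H, Associated h h' → h = h') (hf : ∀ k, g k =
        algebraMap ℂ K (t k) * ∏ h ∈ H, algebraMap (MvPolynomial (Fin m) ℂ) K h ^ c h k)
    {h : MvPolynomial (Fin m) ℂ} (hh : h ∈ H) (hc : c h ≠ 0) :
    ∃ b : ℂˣ, algebraMap (MvPolynomial (Fin m) ℂ) K h = algebraMap ℂ K b * rowForm K (c h) := by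
  classical
  have h0 : ∀ h ∈ H, algebraMap (MvPolynomial (Fin m) ℂ) K h ≠ 0 := fun h hh =>
    (map_ne_zero_iff _ (IsFractionRing.injective _ K)).2 (hp h hh).ne_zero
  let l : MvPolynomial (Fin m) ℂ → MvPolynomial (Fin m) ℂ := fun h =>
    linPoly (fun _ : Fin 1 => c h) 0
  have hl : ∀ h, algebraMap (MvPolynomial (Fin m) ℂ) K (l h) = rowForm K (c h) := fun h =>
    algebraMap_linPoly _ _
  -- The system for D = ∂/∂u_j reads ∑_h l_h ∂_j h / h = 0, and residues are compared.
  have hdvd : ∀ j, h ∣ l h * pderiv j h := fun j => by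
    obtain ⟨D, hD⟩ := exists_derivation_algebraMap_X K (Pi.single j 1)
    have hDp : ∀ p, D (algebraMap (MvPolynomial (Fin m) ℂ) K p) =
        algebraMap (MvPolynomial (Fin m) ℂ) K (pderiv j p) := fun p => by
      rw [derivation_algebraMap, Finset.sum_eq_single j]
      · rw [hD, Pi.single_eq_same, mul_one]
      · intro i _ hij
        rw [hD, Pi.single_eq_of_ne hij, mul_zero]
      · simp
    refine prime_dvd_of_sum_div_eq_zero (K := K) H hp hH (fun h => l h * pderiv j h) ?_ h hh
    have h1 := hg.sum_eq_zero D
    simp only [hf, derivation_zpow_prod_div D H _ h0 _ _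
      (by simp : algebraMap ℂ K (t _) ≠ 0), Finset.mul_sum] at h1
    rw [Finset.sum_comm] at h1
    rw [← h1]
    refine Finset.sum_congr rfl fun p _ => ?_
    rw [map_mul, hl, hDp, rowForm, Finset.sum_mul, Finset.sum_div]
    exact Finset.sum_congr rfl fun k _ => by ring
  have hpos := totalDegree_pos_of_prime (hp h hh)
  obtain ⟨j, hj⟩ : ∃ j, pderiv j h ≠ 0 := by
    by_contra! hcon
    exact hpos.ne' (totalDegree_eq_zero_of_forall_pderiv_eq_zero hcon)
  have hlh : h ∣ l h := ((hp h hh).dvd_or_dvd (hdvd j)).resolve_right fun hd =>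
    hj (eq_zero_of_dvd_of_totalDegree_lt hd (totalDegree_pderiv_lt hpos j))
  obtain ⟨b, hb⟩ := exists_eq_C_mul_of_dvd_linPoly hc (hp h hh) hlh
  refine ⟨b, ?_⟩
  conv_lhs => rw [hb]
  rw [map_mul, algebraMap_C, ← hl]

omit [IsFractionRing (MvPolynomial (Fin m) ℂ) K] in
-- By Euler's identity, E multiplies numerator and denominator by the same degree, so it kills their
-- quotient.
theorem euler_derivation_generic {φ : ProjToAff m m} {E : Derivation ℂ K K}
    (hE : ∀ i, E (algebraMap (MvPolynomial (Fin m) ℂ) K (X i)) =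
      algebraMap (MvPolynomial (Fin m) ℂ) K (X i)) (k : Fin m) : E (φ.generic K k) = 0 := by
  have hhom : ∀ {P : MvPolynomial (Fin m) ℂ}, P.IsHomogeneous φ.deg →
      E (algebraMap (MvPolynomial (Fin m) ℂ) K P) =
        φ.deg * algebraMap (MvPolynomial (Fin m) ℂ) K P := fun {P} hP => by
    rw [derivation_algebraMap]
    simp only [hE, ← map_mul, ← map_sum]
    simp only [mul_comm (pderiv _ P)]
    rw [hP.sum_X_mul_pderiv]
    simp
  rw [ProjToAff.generic, Derivation.leibniz_div, hhom (φ.num_homogeneous k),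
    hhom φ.den_homogeneous]
  simp only [smul_eq_mul]
  ring

omit [IsFractionRing (MvPolynomial (Fin m) ℂ) K] [IsScalarTower ℂ (MvPolynomial (Fin m) ℂ) K] in
theorem euler_derivation_rowForm {E : Derivation ℂ K K}
    (hE : ∀ i, E (algebraMap (MvPolynomial (Fin m) ℂ) K (X i)) =
      algebraMap (MvPolynomial (Fin m) ℂ) K (X i)) (r : Fin m → ℤ) :
    E (rowForm K r) = rowForm K r := by
  simp only [rowForm, map_sum, Derivation.leibniz, hE, Derivation.map_intCast, smul_eq_mul,
    mul_zero, add_zero]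

end monomials

/-! ### Construction of the Horn matrix -/

section assembly

variable {m : ℕ} {K : Type*} [Field K] [Algebra (MvPolynomial (Fin m) ℂ) K]
  [IsFractionRing (MvPolynomial (Fin m) ℂ) K]

omit [IsFractionRing (MvPolynomial (Fin m) ℂ) K] in
theorem rowForm_single (j : Fin m) (a : ℤ) : rowForm K (Pi.single j a) =
    (a : K) * algebraMap (MvPolynomial (Fin m) ℂ) K (X j) := by
  rw [rowForm, Finset.sum_eq_single j]
  · rw [Pi.single_eq_same]
  · intro i _ hij
    rw [Pi.single_eq_of_ne hij, Int.cast_zero, zero_mul]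
  · simp

/-- Adding the rows `± e_j` to a family of rows makes it a matrix of full rank and only changes the
sign of the parametrization. -/
theorem exists_isHornMatrix {ι : Type*} [Fintype ι] (r : ι → Fin m → ℤ) (h0 : ∀ i, r i ≠ 0)
    (hs : ∀ k, ∑ i, r i k = 0) : ∃ (n : ℕ) (C : Matrix (Fin n) (Fin m) ℤ), IsHornMatrix C ∧
      ∀ k, ∏ i, rowForm K (C i) ^ C i k = - ∏ i, rowForm K (r i) ^ r i k := by
  classical
  let R : ι ⊕ (Fin m × Bool) → Fin m → ℤ :=
    Sum.elim r fun p => Pi.single p.1 (if p.2 then 1 else -1)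
  let e := (Fintype.equivFin (ι ⊕ (Fin m × Bool))).symm
  refine ⟨_, fun a => R (e a), ⟨fun k => ?_, fun a => ?_, ?_⟩, fun k => ?_⟩
  · rw [Equiv.sum_comp e fun a => R a k, Fintype.sum_sum_type]
    simp only [R, Sum.elim_inl, Sum.elim_inr, hs k, zero_add, Fintype.sum_prod_type,
      Fintype.sum_bool]
    refine Finset.sum_eq_zero fun j _ => ?_
    by_cases hj : k = j
    · subst hj
      simp
    · simp [Pi.single_eq_of_ne hj]
  · show R (e a) ≠ 0
    rcases e a with i | ⟨j, b⟩
    · exact h0 i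
    · simp only [R, Sum.elim_inr, ne_eq, Pi.single_eq_zero_iff]
      cases b <;> simp
  · rw [Matrix.rank, LinearMap.finrank_range_of_inj, Module.finrank_fin_fun]
    rw [← LinearMap.ker_eq_bot, LinearMap.ker_eq_bot']
    intro w hw
    ext j
    have := congrFun hw (e.symm (Sum.inr (j, true)))
    change ∑ x, ((R (e (e.symm (Sum.inr (j, true)))) x : ℤ) : ℚ) * w x = 0 at this
    simpa [R, Pi.single_apply] using this
  · rw [Equiv.prod_comp e fun a => rowForm K (R a) ^ R a k, Fintype.prod_sum_type]
    simp only [R, Sum.elim_inl, Sum.elim_inr, Fintype.prod_prod_type, Fintype.prod_bool,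
      rowForm_single]
    -- Of the added rows only ±e_k contribute to column k, with the factor u_k · (−u_k)⁻¹ = −1.
    rw [Finset.prod_eq_single k]
    · have hX := algebraMap_X_ne_zero (K := K) k
      simp only [Pi.single_eq_same, if_true, Bool.false_eq_true, if_false, zpow_one, Int.cast_one,
        one_mul, Int.cast_neg, neg_mul, zpow_neg]
      field_simp
    · intro j _ hj
      simp [Pi.single_eq_of_ne hj.symm]
    · simp

end assembly

/-- The rows are the non-zero exponent vectors of the primes. The Euler derivation fixes each linear
form and kills g_k, so its logarithmic derivative of g_k is the column sum, which is therefore 0. -/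
theorem IsLogGaussSection.exists_isHornMatrix {m : ℕ} {K : Type*} [Field K]
    [Algebra (MvPolynomial (Fin m) ℂ) K] [IsFractionRing (MvPolynomial (Fin m) ℂ) K] [Algebra ℂ K]
    [IsScalarTower ℂ (MvPolynomial (Fin m) ℂ) K] {φ : ProjToAff m m}
    (hg : IsLogGaussSection K (φ.generic K)) :
    ∃ (n : ℕ) (C : Matrix (Fin n) (Fin m) ℤ) (τ : Fin m → ℂˣ), IsHornMatrix C ∧
      ∀ k, φ.generic K k = algebraMap ℂ K (τ k) * ∏ i, rowForm K (C i) ^ C i k := by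
  classical
  have hK : CharZero K := charZero_of_injective_algebraMap (algebraMap ℂ K).injective
  obtain ⟨H, t, c, hp, hH, hf⟩ := exists_prime_monomials hg.ne_zero
  have hlin := fun h (hh : h ∈ H) (hc : c h ≠ 0) => hg.exists_eq_mul_rowForm hp hH hf hh hc
  choose! b hb using hlin
  have h0 : ∀ h ∈ H, algebraMap (MvPolynomial (Fin m) ℂ) K h ≠ 0 := fun h hh =>
    (map_ne_zero_iff _ (IsFractionRing.injective _ K)).2 (hp h hh).ne_zero
  obtain ⟨E, hE⟩ := exists_derivation_algebraMap_X K
    fun i => algebraMap (MvPolynomial (Fin m) ℂ) K (X i)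
  have hfilter : ∀ k, ∀ h ∈ H, h ∉ H.filter (fun h => c h ≠ 0) → c h k = 0 := fun k h hh hn => by
    simp only [Finset.mem_filter, hh, true_and, not_not] at hn
    rw [hn]
    rfl
  have hsum : ∀ k, ∑ h ∈ H.filter (fun h => c h ≠ 0), c h k = 0 := fun k => by
    have h1 : E (φ.generic K k) / φ.generic K k = 0 := by
      rw [euler_derivation_generic hE k, zero_div]
    rw [hf k, derivation_zpow_prod_div E H _ h0 _ _ (by simp : algebraMap ℂ K (t k) ≠ 0),
      ← Finset.sum_subset (Finset.filter_subset (fun h => c h ≠ 0) H)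
        fun h hh hn => by rw [hfilter k h hh hn]; simp] at h1
    have h2 : ∀ h ∈ H.filter (fun h => c h ≠ 0), (c h k : K) *
        E (algebraMap (MvPolynomial (Fin m) ℂ) K h) / algebraMap (MvPolynomial (Fin m) ℂ) K h =
        ((c h k : ℤ) : K) := fun h hh => by
      rw [Finset.mem_filter] at hh
      have h3 : E (algebraMap (MvPolynomial (Fin m) ℂ) K h) =
          algebraMap (MvPolynomial (Fin m) ℂ) K h := by
        rw [hb h hh.1 hh.2, Derivation.leibniz, euler_derivation_rowForm hE,
          Derivation.map_algebraMap, smul_zero, add_zero, smul_eq_mul]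
      rw [h3, mul_div_cancel_right₀ _ (h0 h hh.1)]
    rw [Finset.sum_congr rfl h2, ← Int.cast_sum, Int.cast_eq_zero] at h1
    exact h1
  obtain ⟨n, C, hC, hprod⟩ := HornKapranov.exists_isHornMatrix (K := K)
    (fun h : H.filter (fun h => c h ≠ 0) => c h)
    (fun h => (Finset.mem_filter.1 h.2).2) (fun k => by
      rw [Finset.sum_coe_sort (H.filter fun h => c h ≠ 0) fun h => c h k]
      exact hsum k)
  -- The translation absorbs the constants b_h between the primes and the linear forms, and the sign
  -- caused by the rows ±e_j.
  refine ⟨n, C, fun k => - (t k * ∏ h ∈ H.filter (fun h => c h ≠ 0), b h ^ c h k), hC,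
    fun k => ?_⟩
  rw [hprod, hf k, ← Finset.prod_subset (Finset.filter_subset (fun h => c h ≠ 0) H)
        fun h hh hn => by rw [hfilter k h hh hn, zpow_zero],
      Finset.prod_coe_sort (H.filter fun h => c h ≠ 0) fun h => rowForm K (c h) ^ c h k,
      Finset.prod_congr rfl fun h hh => by
        rw [hb h (Finset.mem_filter.1 hh).1 (Finset.mem_filter.1 hh).2, mul_zpow],
      Finset.prod_mul_distrib]
  simp only [Units.val_neg, Units.val_mul, Units.coe_prod, Units.val_zpow_eq_zpow_val, map_neg,
    map_mul, map_prod, map_zpow₀]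
  ring

/-! ### Torus translations -/

/-- The pull-back of polynomials along a torus translation. -/
noncomputable def scale {m : ℕ} (τ : Fin m → ℂˣ) :
    MvPolynomial (Fin m) ℂ ≃ₐ[ℂ] MvPolynomial (Fin m) ℂ :=
  AlgEquiv.ofAlgHom (aeval fun j => C (τ j : ℂ) * X j) (aeval fun j => C ((τ j)⁻¹ : ℂ) * X j)
    (by
      ext j
      simp [← mul_assoc, ← C_mul])
    (by
      ext j
      simp [← mul_assoc, ← C_mul])

theorem eval_scale {m : ℕ} (τ : Fin m → ℂˣ) (y : Fin m → ℂ) (Q : MvPolynomial (Fin m) ℂ) :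
    eval y (scale τ Q) = eval (fun j => (τ j : ℂ) * y j) Q := by
  show eval y (aeval (fun j => C (τ j : ℂ) * X j) Q) = _
  rw [← aeval_eq_eval, ← aeval_eq_eval, ← bind₁, aeval_bind₁]
  simp

theorem torusTranslate_zariskiClosure {m : ℕ} (τ : Fin m → ℂˣ) (V : Set (Fin m → ℂ)) :
    torusTranslate τ (zariskiClosure V) = zariskiClosure (torusTranslate τ V) := by
  have hle : ∀ (τ : Fin m → ℂˣ) (V : Set (Fin m → ℂ)),
      torusTranslate τ (zariskiClosure V) ⊆ zariskiClosure (torusTranslate τ V) := by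
    rintro τ V _ ⟨y, hy, rfl⟩ Q hQ
    have := hy (scale τ Q) fun z hz => by
      rw [aeval_eq_eval, eval_scale, ← aeval_eq_eval]
      exact hQ _ ⟨z, hz, rfl⟩
    rwa [aeval_eq_eval, eval_scale, ← aeval_eq_eval] at this
  refine (hle τ V).antisymm fun y hy => ?_
  have h1 := hle (fun j => (τ j)⁻¹) (torusTranslate τ V) ⟨y, hy, rfl⟩
  have h2 : torusTranslate (fun j => (τ j)⁻¹) (torusTranslate τ V) = V := by
    simp [torusTranslate, Set.image_image]
  rw [h2] at h1
  exact ⟨_, h1, by simp⟩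

theorem IsMinimalEquation.of_torusTranslate {m : ℕ} {τ : Fin m → ℂˣ} {V : Set (Fin m → ℂ)}
    {Δ : MvPolynomial (Fin m) ℂ} (h : IsMinimalEquation Δ (torusTranslate τ V)) :
    IsMinimalEquation (scale τ Δ) V := by
  refine ⟨(MulEquiv.irreducible_iff (scale τ)).2 h.irreducible, Set.ext fun y => ?_⟩
  have hinj : Function.Injective fun (y : Fin m → ℂ) k => (τ k : ℂ) * y k := fun y z hyz =>
    funext fun k => mul_left_cancel₀ (τ k).ne_zero (congrFun hyz k)
  rw [← hinj.mem_set_image (s := V)]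
  change _ ∈ torusTranslate τ V ↔ _
  rw [h.zeroSet]
  simp only [Set.mem_ofPred_eq, eval_scale]

theorem ProjToAff.image_translate {k m : ℕ} (τ : Fin m → ℂˣ) (φ : ProjToAff k m) :
    (φ.translate τ).image = torusTranslate τ φ.image := by
  have hval : ∀ u, (φ.translate τ).value u = fun j => (τ j : ℂ) * φ.value u j := fun u => by
    ext j
    simp [ProjToAff.value, ProjToAff.translate, mul_div_assoc]
  ext y
  constructor
  · rintro ⟨u, hu, rfl⟩
    exact ⟨φ.value u, ⟨u, hu, rfl⟩, (hval u).symm⟩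
  · rintro ⟨_, ⟨u, hu, rfl⟩, rfl⟩
    exact ⟨u, hu, hval u⟩

/-! ### The hypersurfaces of non-defective Horn matrices -/

section horn

variable {m n : ℕ} {C : Matrix (Fin n) (Fin m) ℤ}

/-- Without negative entries, the vanishing column sums would force C = 0, against rank m ≥ 1. So
the affine domain of ψ_C consists of representatives of projective points. -/
theorem IsHornMatrix.zero_notMem_psiDomain (hm : 1 ≤ m) (hC : IsHornMatrix C) :
    (0 : Fin m → ℂ) ∉ psiDomain C := by
  intro h
  have hneg : ∀ i k, 0 ≤ C i k := fun i k => by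
    by_contra! hlt
    exact h i k hlt (by simp [linForm])
  have h0 : ∀ i, C i = 0 := fun i => funext fun k =>
    (Finset.sum_eq_zero_iff_of_nonneg fun i _ => hneg i k).1 (hC.regular k) i (Finset.mem_univ i)
  have hr := hC.full_rank
  rw [show C = 0 from funext h0] at hr
  simp at hr
  omega

theorem image_hornKapranov (hm : 1 ≤ m) (hC : IsHornMatrix C) :
    (hornKapranov C hC).image = psi C '' psiDomain C := by
  ext y
  constructor
  · rintro ⟨u, hu, rfl⟩
    rw [← u.mk_rep] at hu ⊢
    rw [hornKapranov_definedAt_mk] at hu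
    exact ⟨_, hu, (hornKapranov_value_mk hC _ _ hu).symm⟩
  · rintro ⟨u, hu, rfl⟩
    have hu0 : u ≠ 0 := fun h => hC.zero_notMem_psiDomain hm (h ▸ hu)
    exact ⟨_, (hornKapranov_definedAt_mk hC u hu0).2 hu, hornKapranov_value_mk hC u hu0 hu⟩

theorem torusTranslate_SC (hm : 1 ≤ m) (hC : IsHornMatrix C) (τ : Fin m → ℂˣ) :
    torusTranslate τ (SC C) = zariskiClosure ((hornKapranov C hC).translate τ).image := by
  rw [SC, torusTranslate_zariskiClosure, ← image_hornKapranov hm hC, ProjToAff.image_translate]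

theorem torusTranslate_one (V : Set (Fin m → ℂ)) : torusTranslate (fun _ => 1) V = V := by
  simp [torusTranslate]

/-- Krull's principal ideal theorem bounds the height by 1. -/
theorem IsMinimalEquation.not_defective {Δ : MvPolynomial (Fin m) ℂ}
    (h : IsMinimalEquation Δ (SC C)) : ¬ Defective C := by
  rw [Defective, codim, h.vanishingIdeal_eq, not_lt]
  have : (Ideal.span {Δ}).IsPrime :=
    (Ideal.span_singleton_prime h.irreducible.ne_zero).2 h.irreducible.prime
  exact Ideal.height_le_one_of_isPrincipal_of_mem_minimalPrimes (Ideal.span {Δ}) _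
    (by rw [Ideal.minimalPrimes_eq_subsingleton_self]; rfl)

/-- The image of a non-defective Horn–Kapranov parametrization is dense in a hypersurface. -/
theorem IsHornMatrix.exists_isMinimalEquation (hm : 1 ≤ m) (hC : IsHornMatrix C)
    (hd : ¬ Defective C) : ∃ Δ, IsMinimalEquation Δ (SC C) := by
  let K := FractionRing (MvPolynomial (Fin m) ℂ)
  have hI : vanishingIdeal ℂ (SC C) = RingHom.ker
      (aeval (((hornKapranov C hC).translate fun _ => 1).generic K) : _ →ₐ[ℂ] K) := by
    rw [← torusTranslate_one (SC C), torusTranslate_SC hm hC, vanishingIdeal_zariskiClosure,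
      ProjToAff.vanishingIdeal_image (K := K) hm]
  have hprime : (vanishingIdeal ℂ (SC C)).IsPrime := hI ▸ RingHom.ker_isPrime _
  rw [Defective, codim, not_lt] at hd
  have h0 : (vanishingIdeal ℂ (SC C)).height ≠ 0 := by
    intro h0
    rw [Ideal.height_eq_zero_iff_eq_bot, hI] at h0
    exact (isLogGaussSection_hornKapranov (K := K) hC _).not_algebraicIndependent hm
      ((RingHom.injective_iff_ker_eq_bot _).2 h0)
  have h1 : (vanishingIdeal ℂ (SC C)).height = 1 :=
    le_antisymm hd (Order.one_le_iff_ne_zero.2 h0)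
  -- The height is exactly 1, and in a factorial ring a prime ideal of height 1 is principal.
  obtain ⟨Δ, hΔ⟩ := (UniqueFactorizationMonoid.isPrincipal_of_height_eq_one h1).principal
  have hΔ' : vanishingIdeal ℂ (SC C) = Ideal.span {Δ} := hΔ
  have hΔ0 : Δ ≠ 0 := fun h => h0 (by rw [hΔ', h, Ideal.span_singleton_zero, Ideal.height_bot])
  refine ⟨Δ, ?_, ?_⟩
  · rw [hΔ', Ideal.span_singleton_prime hΔ0] at hprime
    exact hprime.irreducible
  · have : SC C = zariskiClosure (SC C) := by
      rw [zariskiClosure, SC, vanishingIdeal_zariskiClosure]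
      rfl
    rw [this, zariskiClosure, hΔ', zeroLocus_span]
    ext x
    simp [aeval_eq_eval]

theorem isGenericLeftInverse_hornKapranov (K : Type*) [Field K]
    [Algebra (MvPolynomial (Fin m) ℂ) K] [IsFractionRing (MvPolynomial (Fin m) ℂ) K] [Algebra ℂ K]
    [IsScalarTower ℂ (MvPolynomial (Fin m) ℂ) K] (hm : 1 ≤ m) (hC : IsHornMatrix C)
    {τ : Fin m → ℂˣ} {Δ : MvPolynomial (Fin m) ℂ}
    (hΔ : IsMinimalEquation Δ (torusTranslate τ (SC C))) :
    IsGenericLeftInverse K (logGauss Δ) ((hornKapranov C hC).translate τ) := by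
  refine (isLogGaussSection_hornKapranov hC τ).isGenericLeftInverse hΔ.irreducible fun Q => ?_
  rw [← Ideal.mem_span_singleton, ← hΔ.vanishingIdeal_eq, torusTranslate_SC hm hC,
    vanishingIdeal_zariskiClosure, ProjToAff.mem_vanishingIdeal_image_iff (K := K) hm]

theorem mutuallyInverse_logGauss_hornKapranov (hm : 1 ≤ m) (hC : IsHornMatrix C)
    {τ : Fin m → ℂˣ} {Δ : MvPolynomial (Fin m) ℂ}
    (hΔ : IsMinimalEquation Δ (torusTranslate τ (SC C))) :
    MutuallyInverse (torusTranslate τ (SC C)) (logGauss Δ)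
      ((hornKapranov C hC).translate τ) := by
  rw [torusTranslate_SC hm hC]
  exact (isGenericLeftInverse_hornKapranov (FractionRing (MvPolynomial (Fin m) ℂ)) hm hC
    hΔ).mutuallyInverse hm

theorem translate_one_hornKapranov (hC : IsHornMatrix C) :
    (hornKapranov C hC).translate (fun _ => 1) = hornKapranov C hC := by
  simp [ProjToAff.translate]

/-- Where the Gauss vector at y is non-zero, every preimage u of y equals γ(y), because γ ∘ ψ_C is
the identity wherever defined. -/
theorem hasDegree_one_hornKapranov (hm : 1 ≤ m) (hC : IsHornMatrix C) (hd : ¬ Defective C) :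
    (hornKapranov C hC).HasDegree 1 := by
  obtain ⟨Δ, hΔ⟩ := hC.exists_isMinimalEquation hm hd
  rw [← torusTranslate_one (SC C)] at hΔ
  have hinv := isGenericLeftInverse_hornKapranov (FractionRing (MvPolynomial (Fin m) ℂ)) hm hC hΔ
  rw [translate_one_hornKapranov] at hinv
  obtain ⟨P, hP, hgen⟩ := (hinv.mutuallyInverse hm).1
  refine ⟨P, hP, fun y hy hPy => ?_⟩
  obtain ⟨hv, hdef, heq⟩ := hgen y hy hPy
  rw [Nat.cast_one, Set.encard_eq_one]
  refine ⟨(logGauss Δ).value y hv, Set.eq_singleton_iff_unique_mem.2 ⟨⟨hdef, heq⟩, ?_⟩⟩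
  rintro u ⟨hu, rfl⟩
  exact (hinv.value_eq hu hv).symm

end horn

/-! ### From birational Gauss maps to Horn matrices, and the theorem -/

/-- A hypersurface with birational logarithmic Gauss map is a translate of some `S_C`. -/
theorem exists_hornMatrix_of_isBirationalOn {m : ℕ} (hm : 1 ≤ m) {S : Set (Fin m → ℂ)}
    {Δ : MvPolynomial (Fin m) ℂ} (hΔ : IsMinimalEquation Δ S)
    (h : (logGauss Δ).IsBirationalOn S) :
    ∃ (n : ℕ) (C : Matrix (Fin n) (Fin m) ℤ) (τ : Fin m → ℂˣ),
      IsHornMatrix C ∧ ¬ Defective C ∧ S = torusTranslate τ (SC C) := by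
  let K := FractionRing (MvPolynomial (Fin m) ℂ)
  obtain ⟨φ, hφ⟩ := h
  have hprime : (vanishingIdeal ℂ S).IsPrime := hΔ.vanishingIdeal_eq ▸
    (Ideal.span_singleton_prime hΔ.irreducible.ne_zero).2 hΔ.irreducible.prime
  have hI := fun Q => hφ.mem_vanishingIdeal_iff (K := K) hm hprime (Q := Q)
  have hmem : Δ ∈ vanishingIdeal ℂ S :=
    hΔ.vanishingIdeal_eq ▸ Ideal.mem_span_singleton_self Δ
  obtain ⟨n, C, τ, hC, hgen⟩ := ((hφ.isGenericLeftInverse (K := K) hm).isLogGaussSection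
    ((hI Δ).1 hmem)).exists_isHornMatrix
  have hS : S = torusTranslate τ (SC C) := by
    -- Equal generic values give equal vanishing ideals, and S is closed.
    have hg : φ.generic K = ((hornKapranov C hC).translate τ).generic K := by
      ext k
      rw [hgen, generic_translate_hornKapranov]
    have hV : vanishingIdeal ℂ S =
        vanishingIdeal ℂ ((hornKapranov C hC).translate τ).image := by
      ext Q
      rw [hI, ProjToAff.mem_vanishingIdeal_image_iff (K := K) hm, hg]
    rw [torusTranslate_SC hm hC, zariskiClosure, ← hV]
    exact hΔ.zariskiClosure_eq.symm
  exact ⟨n, C, τ, hC, (hS ▸ hΔ).of_torusTranslate.not_defective, hS⟩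

end HornKapranov

open HornKapranov in
theorem mainTheorem1 (m : ℕ) (hm : 1 ≤ m) :
    (∀ (S : Set (Fin m → ℂ)) (Δ : MvPolynomial (Fin m) ℂ), IsMinimalEquation Δ S →
      ((logGauss Δ).IsBirationalOn S ↔
        ∃ (n : ℕ) (C : Matrix (Fin n) (Fin m) ℤ) (τ : Fin m → ℂˣ),
          IsHornMatrix C ∧ ¬ Defective C ∧ S = torusTranslate τ (SC C)) ∧
      (∀ (n : ℕ) (C : Matrix (Fin n) (Fin m) ℤ) (τ : Fin m → ℂˣ) (hC : IsHornMatrix C),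
        ¬ Defective C → S = torusTranslate τ (SC C) →
          ((hornKapranov C hC).translate τ).IsBirationalOnto S ∧
          MutuallyInverse S (logGauss Δ) ((hornKapranov C hC).translate τ))) ∧
    (∀ (n : ℕ) (C : Matrix (Fin n) (Fin m) ℤ) (hC : IsHornMatrix C),
      ¬ Defective C → (hornKapranov C hC).HasDegree 1) := by
  refine ⟨fun S Δ hΔ => ⟨⟨exists_hornMatrix_of_isBirationalOn hm hΔ, ?_⟩, ?_⟩,
    fun n C hC hd => hasDegree_one_hornKapranov hm hC hd⟩
  · rintro ⟨n, C, τ, hC, -, rfl⟩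
    exact ⟨_, mutuallyInverse_logGauss_hornKapranov hm hC hΔ⟩
  · rintro n C τ hC - rfl
    have h := mutuallyInverse_logGauss_hornKapranov hm hC hΔ
    exact ⟨⟨_, h⟩, h⟩
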